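/- There is an absolute constant $c_0>0$ with the following property. Let $\epsilon_0\in(0,1)$, let $(p_n)$ be a sequence in $[0,1]$ with $n^{\epsilon_0-1}\le p_n\le \tfrac12$ for all sufficiently large $n$, and let $(m_n)$ be a sequence of natural numbers with $$\frac{1}{c_0\epsilon_0}\le m_n\le \frac{c_0\epsilon_0\log n}{\log\log n}$$ for all sufficiently large $n$. For each $n$ let $A=A_n=(a_{ij})_{1\le i,j\le n}$ be a random real symmetric matrix (the matrices for different $n$ may live on different probability spaces) whose entries $(a_{ij})_{1\le i\le j\le n}$ on and above the diagonal are independent with $\mathbb P(a_{ij}=1)=p_n$ and $\mathbb P(a_{ij}=0)=1-p_n$. Then, writing $m=m_n$, $$\frac{\operatorname{tr}(A^{2m})-\mathbb E[\operatorname{tr}(A^{2m})]}{2m\,(np_n)^{2m-1}\sqrt{p_n(1-p_n)}}\;\Longrightarrow\;N(0,2)\qquad (n\to\infty)$$ in distribution, where $N(0,2)$ is the centered normal law with variance $2$. -/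

import Mathlib

/-! The entries of `A` are almost surely idempotent, so `tr (A ^ N)` is a sum, over closed walks of
length `N`, of square-free monomials in the independent entries. The covariance of two such
monomials vanishes unless the walks share an edge. Pairs of walks which share one edge and have no
other coincidence give the variance `2 (N (np) ^ (N - 1)) ^ 2 p (1 - p)`, and every further
coincidence among their vertices costs a factor `(2N) ^ 2 / (np)`. If the union of the walks has
fewer than two independent cycles, powers of `1 / p` are lost, but then at least about `N / 4`
vertices coincide, which more than compensates.

The linear statistic, a multiple of the centered sum of all independent entries, asymptotically has
the same variance, `2`, and covariance `2` with the normalized trace. Their difference therefore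
tends to zero in `L²`, and the central limit theorem for triangular arrays of small bounded
variables applies to the linear statistic.
-/

open MeasureTheory ProbabilityTheory Filter Topology

/-- `A` is a random real symmetric `n × n` matrix on the probability space `(Ω, P)` whose entries
on and above the diagonal are independent Bernoulli variables, equal to `1` with probability `p`
and to `0` with probability `1 - p`. -/
structure IsSymmBernoulliMatrix {Ω : Type*} [MeasurableSpace Ω] (P : Measure Ω) {n : ℕ}
    (p : unitInterval) (A : Ω → Matrix (Fin n) (Fin n) ℝ) : Prop where
  isSymm : ∀ ω, (A ω).IsSymm
  hasLaw : ∀ i j : Fin n, i ≤ j → HasLaw (fun ω ↦ A ω i j) (bernoulliMeasure (1 : ℝ) 0 p) P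
  iIndepFun : iIndepFun (fun (e : {e : Fin n × Fin n // e.1 ≤ e.2}) ω ↦ A ω e.1.1 e.1.2) P

/-- The centered trace `tr (A ^ (2m)) - E tr (A ^ (2m))` of a random `n × n` matrix, divided by
`2m (np)^(2m-1) √(p(1-p))`. -/
noncomputable def normalizedTrace {Ω : Type*} [MeasurableSpace Ω] (P : Measure Ω) {n : ℕ}
    (p : ℝ) (m : ℕ) (A : Ω → Matrix (Fin n) (Fin n) ℝ) (ω : Ω) : ℝ :=
  (((A ω) ^ (2 * m)).trace - ∫ ω', ((A ω') ^ (2 * m)).trace ∂P) /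
    (2 * (m : ℝ) * ((n : ℝ) * p) ^ (2 * m - 1) * √(p * (1 - p)))

open scoped Finset

section Connectivity

variable {V : Type*}

lemma reachable_fromEdgeSet_of_mem {E : Set (Sym2 V)} {x y : V} (h : s(x, y) ∈ E) :
    (SimpleGraph.fromEdgeSet E).Reachable x y := by
  by_cases hxy : x = y
  · exact hxy ▸ .refl x
  · exact ((SimpleGraph.fromEdgeSet_adj E).2 ⟨h, hxy⟩).reachable

lemma card_le_card_add_one_of_reachable [Finite V] {E : Finset (Sym2 V)} {S : Finset V} {r : V}
    (h : ∀ x ∈ S, (SimpleGraph.fromEdgeSet (E : Set (Sym2 V))).Reachable r x) :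
    #S ≤ #E + 1 := by
  set G := SimpleGraph.fromEdgeSet (E : Set (Sym2 V))
  set C := G.connectedComponentMk r
  have hS : #S ≤ Nat.card C.supp := by
    rw [← Nat.card_eq_finsetCard]
    exact Nat.card_mono (Set.toFinite C.supp) fun x hx ↦
      SimpleGraph.ConnectedComponent.sound (h x hx).symm
  have hE : Nat.card C.toSimpleGraph.edgeSet ≤ #E := by
    have hinj := (SimpleGraph.Embedding.induce (G := G) C.supp).mapEdgeSet.injective
    calc Nat.card C.toSimpleGraph.edgeSet
        ≤ Nat.card G.edgeSet := Nat.card_le_card_of_injective _ hinj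
      _ ≤ Nat.card (E : Set (Sym2 V)) := Nat.card_mono E.finite_toSet (by simp [G])
      _ = #E := by simp
  have := C.connected_toSimpleGraph.card_vert_le_card_edgeSet_add_one
  exact hS.trans (this.trans (Nat.add_le_add_right hE 1))

lemma rel_of_forall_ne_rel_add_one {N : ℕ} [NeZero N] {r : V → V → Prop} (hr : Equivalence r)
    (w : Fin N → V) (c : Fin N) (h : ∀ i ≠ c, r (w i) (w (i + 1))) (a b : Fin N) :
    r (w a) (w b) := by
  obtain ⟨k, rfl⟩ := Nat.exists_eq_succ_of_ne_zero (NeZero.ne N)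
  have from_succ (j : Fin (k + 1)) : r (w (c + 1)) (w (c + 1 + j)) := by
    induction j using Fin.induction with
    | zero => simpa using hr.refl _
    | succ j ih =>
      have hne : c + 1 + j.castSucc ≠ c := by
        rw [add_assoc, add_comm 1, Fin.coeSucc_eq_succ, Ne, add_eq_left]
        exact Fin.succ_ne_zero j
      simpa only [add_assoc, Fin.coeSucc_eq_succ] using hr.trans ih (h _ hne)
  have from_c (x : Fin (k + 1)) : r (w (c + 1)) (w x) := by
    simpa using from_succ (x - (c + 1))
  exact hr.trans (hr.symm (from_c a)) (from_c b)

end Connectivity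

section SinglePositions

variable {V κ : Type*}

/-- The position `i` carries a vertex that the walk `φ` visits at no other position. Walks, and
pairs of walks, are labellings `φ` of a type `κ` of positions by vertices. -/
def IsSingleAt (φ : κ → V) (i : κ) : Prop := ∀ j, φ j = φ i → j = i

lemma IsSingleAt.sym2_eq {φ : κ → V} {i j x y : κ} (hx : IsSingleAt φ x) (hy : IsSingleAt φ y)
    (h : s(φ i, φ j) = s(φ x, φ y)) : s(i, j) = s(x, y) := by
  rcases Sym2.eq_iff.1 h with ⟨hi, hj⟩ | ⟨hi, hj⟩
  · rw [hx i hi, hy j hj]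
  · rw [hy i hi, hx j hj, Sym2.eq_swap]

open scoped Classical in
lemma card_not_isSingleAt_add_two_mul_card_image_le [DecidableEq V] [Fintype κ] (φ : κ → V) :
    #{i | ¬ IsSingleAt φ i} + 2 * #(Finset.univ.image φ) ≤ 2 * Fintype.card κ := by
  set S : Finset κ := {i | IsSingleAt φ i}
  set T : Finset κ := {i | ¬ IsSingleAt φ i}
  have hST : #S + #T = Fintype.card κ := Finset.card_filter_add_card_filter_not _
  have himage : #(Finset.univ.image φ) ≤ #S + #(T.image φ) := by
    rw [← Finset.filter_union_filter_not_eq (IsSingleAt φ) Finset.univ, Finset.image_union]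
    exact (Finset.card_union_le _ _).trans (Nat.add_le_add_right Finset.card_image_le _)
  have hT : 2 * #(T.image φ) ≤ #T := by
    refine Finset.mul_card_image_le_card T 2 fun v hv ↦ ?_
    obtain ⟨i, hi, rfl⟩ := Finset.mem_image.1 hv
    obtain ⟨j, hji, hne⟩ : ∃ j, φ j = φ i ∧ j ≠ i := by
      simpa [T, IsSingleAt] using hi
    have hj : j ∈ T := by
      simpa [T, IsSingleAt] using ⟨i, hji.symm, hne.symm⟩
    exact Finset.one_lt_card.2
      ⟨j, Finset.mem_filter.2 ⟨hj, hji⟩, i, Finset.mem_filter.2 ⟨hi, rfl⟩, hne⟩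
  lia

variable {N : ℕ} [NeZero N]

lemma fin_add_one_add_one_ne_self (hN : 3 ≤ N) (i : Fin N) : i + 1 + 1 ≠ i := by
  obtain ⟨k, rfl⟩ := Nat.exists_eq_add_of_le' hN
  rw [add_assoc, Ne, add_eq_left, Fin.ext_iff]
  simp [Fin.val_add, Nat.mod_eq_of_lt (show 2 < k + 3 by lia)]

lemma mk_add_one_injective (hN : 3 ≤ N) :
    Function.Injective fun i : Fin N ↦ s(i, i + 1) := by
  intro i j hij
  rcases Sym2.eq_iff.1 hij with ⟨h, -⟩ | ⟨h, h'⟩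
  · exact h
  · exact absurd (h ▸ h') (fin_add_one_add_one_ne_self hN j)

lemma two_mul_card_le_of_forall_add_one_notMem {S : Finset (Fin N)} (h : ∀ i ∈ S, i + 1 ∉ S) :
    2 * #S ≤ N := by
  have hdisj : Disjoint S (S.map (addRightEmbedding 1)) := by
    simpa [Finset.disjoint_right] using h
  calc 2 * #S = #(S.disjUnion _ hdisj) := by rw [Finset.card_disjUnion, Finset.card_map, two_mul]
    _ ≤ N := card_finset_fin_le _

open scoped Classical in
lemma exists_isSingleAt_add_one_or_le_two_mul_card [Fintype κ] (φ : κ → V) (g : Fin N ↪ κ) :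
    (∃ c, IsSingleAt φ (g c) ∧ IsSingleAt φ (g (c + 1))) ∨ N ≤ 2 * #{i | ¬ IsSingleAt φ i} := by
  refine or_iff_not_imp_left.2 fun hnot ↦ ?_
  have hsingle : 2 * #{c | IsSingleAt φ (g c)} ≤ N :=
    two_mul_card_le_of_forall_add_one_notMem (by simpa using hnot)
  have hrest : #{c | ¬ IsSingleAt φ (g c)} ≤ #{i | ¬ IsSingleAt φ i} := by
    rw [← Finset.card_map g]
    exact Finset.card_le_card fun x hx ↦ by
      obtain ⟨c, hc, rfl⟩ := Finset.mem_map.1 hx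
      simpa using hc
  have hadd := Finset.card_filter_add_card_filter_not (s := (Finset.univ : Finset (Fin N)))
    (fun c ↦ IsSingleAt φ (g c))
  rw [Finset.card_fin] at hadd
  lia

end SinglePositions

section ClosedWalks

variable {V : Type*} [DecidableEq V] {N : ℕ} [NeZero N]

/-- The set of edges of the closed walk `w 0, w 1, …, w (N - 1), w 0`; the index `i + 1` is taken
modulo `N`. -/
def closedWalkEdges (w : Fin N → V) : Finset (Sym2 V) :=
  Finset.univ.image fun i ↦ s(w i, w (i + 1))

/-- The set of vertices visited by a pair of walks. -/
def pairVertices (w w' : Fin N → V) : Finset V :=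
  Finset.univ.image (Sum.elim w w')

variable {w w' : Fin N → V}

lemma mem_closedWalkEdges {e : Sym2 V} :
    e ∈ closedWalkEdges w ↔ ∃ i, s(w i, w (i + 1)) = e := by
  simp [closedWalkEdges]

omit [NeZero N] in
lemma mem_pairVertices {x : V} : x ∈ pairVertices w w' ↔ (∃ i, w i = x) ∨ ∃ i, w' i = x := by
  simp [pairVertices]

lemma mk_mem_closedWalkEdges (w : Fin N → V) (i : Fin N) :
    s(w i, w (i + 1)) ∈ closedWalkEdges w :=
  mem_closedWalkEdges.2 ⟨i, rfl⟩

lemma card_closedWalkEdges_le (w : Fin N → V) : #(closedWalkEdges w) ≤ N :=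
  Finset.card_image_le.trans (by simp)

lemma card_closedWalkEdges_of_injective (hN : 3 ≤ N) {w : Fin N → V} (hw : w.Injective) :
    #(closedWalkEdges w) = N := by
  rw [closedWalkEdges, Finset.card_image_of_injective, Finset.card_fin]
  exact (Sym2.map.injective hw).comp (mk_add_one_injective hN)

lemma exists_eq_of_inter_nonempty (h : (closedWalkEdges w ∩ closedWalkEdges w').Nonempty) :
    ∃ a b, w a = w' b := by
  obtain ⟨e, he⟩ := h
  obtain ⟨⟨i, rfl⟩, ⟨j, hj⟩⟩ : (∃ i, s(w i, w (i + 1)) = e) ∧ ∃ j, s(w' j, w' (j + 1)) = e := by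
    simpa [mem_closedWalkEdges] using he
  rcases Sym2.eq_iff.1 hj with ⟨h, -⟩ | ⟨-, h⟩
  exacts [⟨i, j, h.symm⟩, ⟨i, j + 1, h.symm⟩]

lemma card_pairVertices_le_of_forall_ne [Finite V] {F : Finset (Sym2 V)} {a b c d : Fin N}
    (hab : w a = w' b) (hw : ∀ i ≠ c, s(w i, w (i + 1)) ∈ F)
    (hw' : ∀ i ≠ d, s(w' i, w' (i + 1)) ∈ F) : #(pairVertices w w') ≤ #F + 1 := by
  set G := SimpleGraph.fromEdgeSet (F : Set (Sym2 V))
  have hreach : ∀ i, G.Reachable (w a) (w i) :=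
    rel_of_forall_ne_rel_add_one G.reachable_is_equivalence w c
      (fun i hi ↦ reachable_fromEdgeSet_of_mem (hw i hi)) a
  have hreach' : ∀ i, G.Reachable (w' b) (w' i) :=
    rel_of_forall_ne_rel_add_one G.reachable_is_equivalence w' d
      (fun i hi ↦ reachable_fromEdgeSet_of_mem (hw' i hi)) b
  refine card_le_card_add_one_of_reachable (r := w a) fun x hx ↦ ?_
  obtain ⟨i, rfl⟩ | ⟨i, rfl⟩ := mem_pairVertices.1 hx
  exacts [hreach i, hab ▸ hreach' i]

lemma card_pairVertices_le_card_union_add_one [Finite V] {a b : Fin N} (hab : w a = w' b) :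
    #(pairVertices w w') ≤ #(closedWalkEdges w ∪ closedWalkEdges w') + 1 :=
  card_pairVertices_le_of_forall_ne (c := 0) (d := 0) hab
    (fun i _ ↦ Finset.mem_union_left _ (mk_mem_closedWalkEdges w i))
    (fun i _ ↦ Finset.mem_union_right _ (mk_mem_closedWalkEdges w' i))

lemma card_pairVertices_add_one_le_card_union [Finite V] (hN : 3 ≤ N) {a b c d : Fin N}
    (hab : w a = w' b)
    (hc : IsSingleAt (Sum.elim w w') (.inl c)) (hc' : IsSingleAt (Sum.elim w w') (.inl (c + 1)))
    (hd : IsSingleAt (Sum.elim w w') (.inr d)) (hd' : IsSingleAt (Sum.elim w w') (.inr (d + 1))) :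
    #(pairVertices w w') + 1 ≤ #(closedWalkEdges w ∪ closedWalkEdges w') := by
  set E := closedWalkEdges w ∪ closedWalkEdges w'
  have hwc (i) (hi : i ≠ c) : s(w i, w (i + 1)) ≠ s(w c, w (c + 1)) := fun h ↦ by
    have := hc.sym2_eq hc' (i := Sum.inl i) (j := Sum.inl (i + 1)) h
    exact hi (mk_add_one_injective hN (Sym2.map.injective Sum.inl_injective this))
  have hwd (i) : s(w i, w (i + 1)) ≠ s(w' d, w' (d + 1)) := fun h ↦ by
    simpa using hd.sym2_eq hd' (i := Sum.inl i) (j := Sum.inl (i + 1)) h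
  have hwc' (i) : s(w' i, w' (i + 1)) ≠ s(w c, w (c + 1)) := fun h ↦ by
    simpa using hc.sym2_eq hc' (i := Sum.inr i) (j := Sum.inr (i + 1)) h
  have hwd' (i) (hi : i ≠ d) : s(w' i, w' (i + 1)) ≠ s(w' d, w' (d + 1)) := fun h ↦ by
    have := hd.sym2_eq hd' (i := Sum.inr i) (j := Sum.inr (i + 1)) h
    exact hi (mk_add_one_injective hN (Sym2.map.injective Sum.inr_injective this))
  have hE' (i) : s(w' i, w' (i + 1)) ∈ E := Finset.mem_union_right _ (mk_mem_closedWalkEdges w' i)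
  have hE (i) : s(w i, w (i + 1)) ∈ E := Finset.mem_union_left _ (mk_mem_closedWalkEdges w i)
  -- A closed walk minus one edge is still connected, so the unrepeated edge of each walk can be
  -- deleted without disconnecting the union.
  have hle := card_pairVertices_le_of_forall_ne (c := c) (d := d)
    (F := (E.erase s(w c, w (c + 1))).erase s(w' d, w' (d + 1))) hab
    (fun i hi ↦ by simp [hE i, hwc i hi, hwd i]) (fun i hi ↦ by simp [hE' i, hwc' i, hwd' i hi])
  have hcard := Finset.card_erase_add_one (hE c)
  have hcard' := Finset.card_erase_add_one (Finset.mem_erase.2 ⟨hwc' d, hE' d⟩)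
  lia

-- With fewer than `N / 2` repeated positions, a closed walk has two consecutive single ones.
lemma card_pairVertices_add_one_le_or [Finite V] (hN : 3 ≤ N) {a b : Fin N} (hab : w a = w' b) :
    #(pairVertices w w') + 1 ≤ #(closedWalkEdges w ∪ closedWalkEdges w') ∨
      4 * #(pairVertices w w') ≤ 7 * N := by
  classical
  set φ : Fin N ⊕ Fin N → V := Sum.elim w w'
  have hcount : #{i | ¬ IsSingleAt φ i} + 2 * #(pairVertices w w') ≤ 2 * (N + N) := by
    simpa [pairVertices] using card_not_isSingleAt_add_two_mul_card_image_le φ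
  rcases exists_isSingleAt_add_one_or_le_two_mul_card φ .inl with ⟨c, hc, hc'⟩ | h
  · rcases exists_isSingleAt_add_one_or_le_two_mul_card φ .inr with ⟨d, hd, hd'⟩ | h
    · exact .inl (card_pairVertices_add_one_le_card_union hN hab hc hc' hd hd')
    · exact .inr (by lia)
  · exact .inr (by lia)

lemma closedWalkEdges_inter_trichotomy [Finite V] (hN : 3 ≤ N) {d : ℕ} (hd : 4 * d ≤ N + 3)
    (h : (closedWalkEdges w ∩ closedWalkEdges w').Nonempty) :
    (#(closedWalkEdges w ∩ closedWalkEdges w') ≤ 1 ∧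
        2 * N ≤ #(closedWalkEdges w ∪ closedWalkEdges w') + 1) ∨
      (#(pairVertices w w') + 3 ≤ 2 * N ∧
        #(pairVertices w w') + 1 ≤ #(closedWalkEdges w ∪ closedWalkEdges w')) ∨
      (#(pairVertices w w') + d ≤ 2 * N ∧
        #(pairVertices w w') ≤ #(closedWalkEdges w ∪ closedWalkEdges w') + 1) := by
  obtain ⟨a, b, hab⟩ := exists_eq_of_inter_nonempty h
  have hconn := card_pairVertices_le_card_union_add_one hab
  have hcycles := card_pairVertices_add_one_le_or hN hab
  have hw := card_closedWalkEdges_le w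
  have hw' := card_closedWalkEdges_le w'
  have hunion := Finset.card_union_add_card_inter (closedWalkEdges w) (closedWalkEdges w')
  lia

end ClosedWalks

section Counting

variable {V κ : Type*} [DecidableEq V] [Fintype V] [Fintype κ]

lemma sum_pow_card_insert_le {y : ℝ} (hy : 0 ≤ y) (I : Finset V) :
    ∑ x, y ^ #(insert x I) ≤ (Fintype.card V * y + #I) * y ^ #I := by
  have hterm (x : V) : y ^ #(insert x I) ≤ y * y ^ #I + if x ∈ I then y ^ #I else 0 := by
    by_cases hx : x ∈ I
    · simpa [hx] using by positivity
    · simp [hx, pow_succ']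
  calc ∑ x, y ^ #(insert x I) ≤ ∑ x, (y * y ^ #I + if x ∈ I then y ^ #I else 0) :=
        Finset.sum_le_sum fun x _ ↦ hterm x
    _ = (Fintype.card V * y + #I) * y ^ #I := by
        simp [Finset.sum_add_distrib]
        ring

lemma sum_pow_card_image_fin_le {y : ℝ} (hy : 0 ≤ y) (k : ℕ) :
    ∑ φ : Fin k → V, y ^ #(Finset.univ.image φ) ≤ (Fintype.card V * y + k) ^ k := by
  induction k with
  | zero => simp
  | succ k ih =>
    have himage (x : V) (φ : Fin k → V) :
        Finset.univ.image (Fin.cons x φ : Fin (k + 1) → V) = insert x (Finset.univ.image φ) := by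
      ext z
      simp [Fin.exists_fin_succ, eq_comm]
    calc ∑ φ : Fin (k + 1) → V, y ^ #(Finset.univ.image φ)
        = ∑ φ : Fin k → V, ∑ x, y ^ #(insert x (Finset.univ.image φ)) := by
          rw [← (Fin.consEquiv fun _ ↦ V).sum_comp, Fintype.sum_prod_type_right]
          simp only [← himage]
          rfl
      _ ≤ ∑ φ : Fin k → V, (Fintype.card V * y + k) * y ^ #(Finset.univ.image φ) := by
          gcongr with φ
          refine (sum_pow_card_insert_le hy _).trans ?_
          gcongr
          exact Finset.card_image_le.trans (by simp)
      _ ≤ (Fintype.card V * y + k) * (Fintype.card V * y + k) ^ k := by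
          rw [← Finset.mul_sum]
          gcongr
      _ ≤ (Fintype.card V * y + (k + 1 : ℕ)) ^ (k + 1) := by
          rw [← pow_succ']
          gcongr
          simp

lemma sum_pow_card_image_le [DecidableEq κ] {y : ℝ} (hy : 0 ≤ y) :
    ∑ φ : κ → V, y ^ #(Finset.univ.image φ) ≤
      (Fintype.card V * y + Fintype.card κ) ^ Fintype.card κ := by
  refine le_of_eq_of_le ?_ (sum_pow_card_image_fin_le (V := V) hy (Fintype.card κ))
  refine Fintype.sum_equiv ((Fintype.equivFin κ).arrowCongr (.refl V)) _ _ fun φ ↦ ?_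
  congr 2
  ext x
  simpa using (Fintype.equivFin κ).exists_congr_left

lemma sum_pow_card_image_of_card_image_add_le [DecidableEq κ] [Nonempty κ] {p : ℝ} (d : ℕ)
    (h : (Fintype.card κ : ℝ) ^ 2 ≤ Fintype.card V * p) :
    ∑ φ : κ → V with #(Finset.univ.image φ) + d ≤ Fintype.card κ, p ^ #(Finset.univ.image φ) ≤
      3 * (Fintype.card V * p) ^ Fintype.card κ *
        ((Fintype.card κ : ℝ) ^ 2 / (Fintype.card V * p)) ^ d := by
  set K := Fintype.card κ
  set n := Fintype.card V
  have hK : (0 : ℝ) < K := by exact_mod_cast Fintype.card_pos (α := κ)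
  have hnp : 0 < n * p := (pow_pos hK 2).trans_le h
  have hp : 0 < p := pos_of_mul_pos_right hnp n.cast_nonneg
  set r := (K : ℝ) ^ 2 / (n * p)
  have hr : 0 < r := by positivity
  have hr1 : r ≤ 1 := (div_le_one hnp).2 h
  have hnpr : n * p * r = K ^ 2 := mul_div_cancel₀ _ hnp.ne'
  have hexp : (1 + (K : ℝ)⁻¹) ^ K ≤ 3 := Real.one_add_inv_pow_le_exp.trans Real.exp_one_lt_three.le
  -- Markov's inequality: `r ^ (K - d - #im φ) ≤ 1` on the event that `φ` has `d` coincidences.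
  have hmarkov (φ : κ → V) (hφ : #(Finset.univ.image φ) + d ≤ K) :
      r ^ K * p ^ #(Finset.univ.image φ) ≤ r ^ d * (p * r) ^ #(Finset.univ.image φ) := by
    rw [mul_pow, mul_comm (p ^ _), ← mul_assoc, ← pow_add, add_comm d]
    gcongr ?_ * _
    exact pow_le_pow_of_le_one hr.le hr1 hφ
  refine le_of_mul_le_mul_left ?_ (pow_pos hr K)
  calc r ^ K * ∑ φ : κ → V with #(Finset.univ.image φ) + d ≤ K, p ^ #(Finset.univ.image φ)
      ≤ ∑ φ : κ → V with #(Finset.univ.image φ) + d ≤ K,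
          r ^ d * (p * r) ^ #(Finset.univ.image φ) := by
        rw [Finset.mul_sum]
        exact Finset.sum_le_sum fun φ hφ ↦ hmarkov φ (Finset.mem_filter.1 hφ).2
    _ ≤ ∑ φ : κ → V, r ^ d * (p * r) ^ #(Finset.univ.image φ) :=
        Finset.sum_le_sum_of_subset_of_nonneg (Finset.filter_subset _ _) fun _ _ _ ↦ by positivity
    _ ≤ r ^ d * (n * (p * r) + K) ^ K := by
        rw [← Finset.mul_sum]
        gcongr
        exact sum_pow_card_image_le (by positivity)
    _ = r ^ d * (n * p * r) ^ K * (1 + (K : ℝ)⁻¹) ^ K := by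
        rw [mul_assoc, ← mul_pow, ← mul_assoc (n : ℝ), hnpr]
        field_simp
    _ ≤ r ^ d * (n * p * r) ^ K * 3 := by gcongr
    _ = r ^ K * (3 * (n * p) ^ K * r ^ d) := by ring

lemma card_filter_forall_mem_eq [DecidableEq κ] (s : Finset κ) (g : κ → V) :
    #{w : κ → V | ∀ i ∈ s, w i = g i} = Fintype.card V ^ (Fintype.card κ - #s) := by
  have hpi : ({w : κ → V | ∀ i ∈ s, w i = g i} : Finset (κ → V)) =
      Fintype.piFinset fun i ↦ if i ∈ s then {g i} else Finset.univ := by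
    ext w
    simp only [Finset.mem_filter, Finset.mem_univ, true_and, Fintype.mem_piFinset]
    refine forall_congr' fun i ↦ ?_
    split_ifs with hi <;> simp [hi]
  simp [hpi, Fintype.card_piFinset, apply_ite Finset.card, Finset.prod_ite, ← Finset.card_compl,
    Finset.filter_not, Finset.compl_eq_univ_sdiff]

end Counting

section CountingWalks

variable {V : Type*} [DecidableEq V] [Fintype V] {N : ℕ} [NeZero N]

lemma card_filter_mk_eq_le (hN : 2 ≤ N) (j : Fin N) (e : Sym2 V) :
    #{w : Fin N → V | s(w j, w (j + 1)) = e} ≤ 2 * Fintype.card V ^ (N - 2) := by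
  induction e using Sym2.ind with | _ x y
  have hj : j ≠ j + 1 := by
    rw [Ne, left_eq_add, Fin.one_eq_zero_iff]
    lia
  have hfiber (x y : V) : #{w : Fin N → V | w j = x ∧ w (j + 1) = y} =
      Fintype.card V ^ (N - 2) := by
    have := card_filter_forall_mem_eq {j, j + 1} (Function.update (fun _ ↦ y) j x)
    simpa [Finset.card_pair hj, hj.symm] using this
  simp only [Sym2.eq_iff, Finset.filter_or]
  refine (Finset.card_union_le _ _).trans_eq ?_
  rw [hfiber, hfiber, two_mul]

lemma card_filter_inter_nonempty_le (hN : 2 ≤ N) (E : Finset (Sym2 V)) :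
    #{w : Fin N → V | (E ∩ closedWalkEdges w).Nonempty} ≤
      #E * (N * (2 * Fintype.card V ^ (N - 2))) := by
  have hsub : ({w : Fin N → V | (E ∩ closedWalkEdges w).Nonempty} : Finset (Fin N → V)) ⊆
      E.biUnion fun e ↦ Finset.univ.biUnion fun j ↦ {w | s(w j, w (j + 1)) = e} := by
    intro w hw
    obtain ⟨e, he⟩ := (Finset.mem_filter.1 hw).2
    obtain ⟨heE, hew⟩ := Finset.mem_inter.1 he
    obtain ⟨j, hj⟩ := mem_closedWalkEdges.1 hew
    simpa using ⟨j, hj ▸ heE⟩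
  refine (Finset.card_le_card hsub).trans (Finset.card_biUnion_le_card_mul _ _ _ fun e _ ↦ ?_)
  simpa using Finset.card_biUnion_le_card_mul Finset.univ _ _ fun j _ ↦ card_filter_mk_eq_le hN j e

lemma card_pairs_inter_nonempty_le (hN : 2 ≤ N) :
    #{x : (Fin N → V) × (Fin N → V) | (closedWalkEdges x.1 ∩ closedWalkEdges x.2).Nonempty} ≤
      2 * N ^ 2 * Fintype.card V ^ (2 * N - 2) := by
  rw [Finset.card_filter, Fintype.sum_prod_type]
  simp only [← Finset.card_filter]
  calc ∑ w : Fin N → V, #{w' : Fin N → V | (closedWalkEdges w ∩ closedWalkEdges w').Nonempty}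
      ≤ ∑ _w : Fin N → V, N * (N * (2 * Fintype.card V ^ (N - 2))) :=
        Finset.sum_le_sum fun w _ ↦ (card_filter_inter_nonempty_le hN _).trans
          (Nat.mul_le_mul_right _ (card_closedWalkEdges_le w))
    _ = 2 * N ^ 2 * Fintype.card V ^ (2 * N - 2) := by
        rw [show 2 * N - 2 = N + (N - 2) by lia, pow_add]
        simp
        ring

omit [Fintype V] in
lemma card_inter_mul_pow_card_union_le [Finite V] (hN : 3 ≤ N) {d : ℕ} (hd : 4 * d ≤ N + 3)
    {p : ℝ} (hp : 0 < p) (hp1 : p ≤ 1) (w w' : Fin N → V) :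
    #(closedWalkEdges w ∩ closedWalkEdges w') * p ^ #(closedWalkEdges w ∪ closedWalkEdges w') ≤
      (if (closedWalkEdges w ∩ closedWalkEdges w').Nonempty then p ^ (2 * N - 1) else 0) +
      N * p * (if #(pairVertices w w') + 3 ≤ 2 * N then p ^ #(pairVertices w w') else 0) +
      N * p⁻¹ * (if #(pairVertices w w') + d ≤ 2 * N then p ^ #(pairVertices w w') else 0) := by
  set I := closedWalkEdges w ∩ closedWalkEdges w'
  set U := closedWalkEdges w ∪ closedWalkEdges w'
  set v := #(pairVertices w w')
  have nonneg₁ : 0 ≤ if I.Nonempty then p ^ (2 * N - 1) else 0 := by positivity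
  have nonneg₂ : 0 ≤ N * p * (if v + 3 ≤ 2 * N then p ^ v else 0) := by positivity
  have nonneg₃ : 0 ≤ N * p⁻¹ * (if v + d ≤ 2 * N then p ^ v else 0) := by positivity
  by_cases hI : I.Nonempty
  swap
  · rw [Finset.not_nonempty_iff_eq_empty.1 hI] at nonneg₁ ⊢
    simp only [Finset.card_empty, Nat.cast_zero, zero_mul]
    positivity
  have hcard : (#I : ℝ) ≤ N := by
    exact_mod_cast (Finset.card_le_card Finset.inter_subset_left).trans (card_closedWalkEdges_le w)
  rcases closedWalkEdges_inter_trichotomy hN hd hI with ⟨hI1, hU⟩ | ⟨hv, hU⟩ | ⟨hv, hU⟩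
  · have : #I * p ^ #U ≤ 1 * p ^ (2 * N - 1) :=
      mul_le_mul (by exact_mod_cast hI1) (pow_le_pow_of_le_one hp.le hp1 (by lia))
        (by positivity) (by positivity)
    rw [if_pos hI]
    linarith
  · have : #I * p ^ #U ≤ N * (p * p ^ v) :=
      mul_le_mul hcard (pow_succ' p v ▸ pow_le_pow_of_le_one hp.le hp1 hU)
        (by positivity) (by positivity)
    rw [if_pos hv] at nonneg₂ ⊢
    linarith
  · have : #I * p ^ #U ≤ N * (p⁻¹ * p ^ v) := by
      refine mul_le_mul hcard ?_ (by positivity) (by positivity)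
      rw [le_inv_mul_iff₀ hp, ← pow_succ']
      exact pow_le_pow_of_le_one hp.le hp1 hU
    rw [if_pos hv] at nonneg₃ ⊢
    linarith

lemma sum_pow_card_pairVertices_le {p : ℝ} (d : ℕ)
    (h : (2 * N : ℝ) ^ 2 ≤ Fintype.card V * p) :
    ∑ x : (Fin N → V) × (Fin N → V),
        (if #(pairVertices x.1 x.2) + d ≤ 2 * N then p ^ #(pairVertices x.1 x.2) else 0) ≤
      3 * (Fintype.card V * p) ^ (2 * N) * ((2 * N : ℝ) ^ 2 / (Fintype.card V * p)) ^ d := by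
  have hcard : Fintype.card (Fin N ⊕ Fin N) = 2 * N := by simp [two_mul]
  have hcoin := sum_pow_card_image_of_card_image_add_le (V := V) (κ := Fin N ⊕ Fin N) (p := p) d
    (by simpa [hcard] using h)
  rw [Finset.sum_filter, hcard, Nat.cast_mul, Nat.cast_ofNat] at hcoin
  refine le_of_eq_of_le ?_ hcoin
  exact Fintype.sum_equiv (Equiv.sumArrowEquivProdArrow _ _ V).symm _ _ fun x ↦ rfl

lemma sum_card_inter_mul_pow_card_union_le (hN : 3 ≤ N) {d : ℕ} (hd : 4 * d ≤ N + 3) {p : ℝ}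
    (hp : 0 < p) (hp1 : p ≤ 1) (h : (2 * N : ℝ) ^ 2 ≤ Fintype.card V * p) :
    ∑ w : Fin N → V, ∑ w' : Fin N → V, #(closedWalkEdges w ∩ closedWalkEdges w') *
        p ^ #(closedWalkEdges w ∪ closedWalkEdges w') ≤
      2 * N ^ 2 * Fintype.card V ^ (2 * N - 2) * p ^ (2 * N - 1) +
      N * p * (3 * (Fintype.card V * p) ^ (2 * N) *
        ((2 * N : ℝ) ^ 2 / (Fintype.card V * p)) ^ 3) +
      N * p⁻¹ * (3 * (Fintype.card V * p) ^ (2 * N) *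
        ((2 * N : ℝ) ^ 2 / (Fintype.card V * p)) ^ d) := by
  rw [← Fintype.sum_prod_type']
  refine (Finset.sum_le_sum fun x _ ↦
    card_inter_mul_pow_card_union_le hN hd hp hp1 x.1 x.2).trans ?_
  rw [Finset.sum_add_distrib, Finset.sum_add_distrib, ← Finset.mul_sum, ← Finset.mul_sum]
  gcongr
  · rw [← Finset.sum_filter, Finset.sum_const, nsmul_eq_mul]
    gcongr
    exact_mod_cast card_pairs_inter_nonempty_le (V := V) (show 2 ≤ N by lia)
  · exact sum_pow_card_pairVertices_le 3 h
  · exact sum_pow_card_pairVertices_le d h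

lemma pow_mul_one_sub_le_descFactorial {n k : ℕ} (hk : k ≤ n) :
    (n : ℝ) ^ k * (1 - k ^ 2 / n) ≤ n.descFactorial k := by
  rcases n.eq_zero_or_pos with rfl | hn
  · simp_all
  have hn' : (0 : ℝ) < n := by exact_mod_cast hn
  have hkn : (k : ℝ) / n ≤ 1 := (div_le_one hn').2 (by exact_mod_cast hk)
  calc (n : ℝ) ^ k * (1 - k ^ 2 / n) = n ^ k * (1 + k * -(k / n)) := by ring
    _ ≤ n ^ k * (1 + -(k / n)) ^ k := by
        gcongr
        exact one_add_mul_le_pow (by linarith) k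
    _ = (n - k : ℕ) ^ k := by
        rw [← mul_pow, Nat.cast_sub hk]
        congr 1
        field_simp
        ring
    _ ≤ (n + 1 - k : ℕ) ^ k := by
        gcongr
        lia
    _ ≤ n.descFactorial k := by exact_mod_cast Nat.pow_sub_le_descFactorial n k

lemma le_sum_card_mul_pow_card_closedWalkEdges (hN : 3 ≤ N) (hNV : N ≤ Fintype.card V) {p : ℝ}
    (hp : 0 ≤ p) :
    N * p ^ N * (Fintype.card V ^ N * (1 - N ^ 2 / Fintype.card V)) ≤
      ∑ w : Fin N → V, #(closedWalkEdges w) * p ^ #(closedWalkEdges w) := by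
  have hinj : #{w : Fin N → V | w.Injective} = (Fintype.card V).descFactorial N := by
    rw [← Fintype.card_subtype, Fintype.card_congr (Equiv.subtypeInjectiveEquivEmbedding _ _),
      Fintype.card_embedding_eq, Fintype.card_fin]
  calc N * p ^ N * (Fintype.card V ^ N * (1 - N ^ 2 / Fintype.card V))
      ≤ N * p ^ N * (Fintype.card V).descFactorial N := by
        gcongr
        exact pow_mul_one_sub_le_descFactorial hNV
    _ = ∑ w : Fin N → V with w.Injective, #(closedWalkEdges w) * p ^ #(closedWalkEdges w) := by
        rw [← hinj, mul_comm, ← nsmul_eq_mul]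
        refine (Finset.sum_eq_card_nsmul fun w hw ↦ ?_).symm
        rw [card_closedWalkEdges_of_injective hN (Finset.mem_filter.1 hw).2]
    _ ≤ ∑ w : Fin N → V, #(closedWalkEdges w) * p ^ #(closedWalkEdges w) :=
        Finset.sum_le_sum_of_subset_of_nonneg (Finset.filter_subset _ _) fun _ _ _ ↦ by positivity

end CountingWalks

section TraceExpansion

variable {V R : Type*} [DecidableEq V] [Fintype V] [CommSemiring R] {N : ℕ} [NeZero N]

lemma sum_prod_castSucc_succ_mul (A : Matrix V V R) (k : ℕ) (g : V → V → R) :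
    ∑ w : Fin (k + 1) → V, (∏ i : Fin k, A (w i.castSucc) (w i.succ)) * g (w 0) (w (.last k)) =
      ∑ x, ∑ y, (A ^ k) x y * g x y := by
  induction k generalizing g with
  | zero =>
    rw [← (Equiv.funUnique (Fin 1) V).symm.sum_comp]
    simp [Matrix.one_apply, Equiv.funUnique]
  | succ k ih =>
    rw [← (Fin.consEquiv fun _ ↦ V).sum_comp, Fintype.sum_prod_type]
    refine Finset.sum_congr rfl fun x _ ↦ ?_
    calc ∑ w : Fin (k + 1) → V, (∏ i : Fin (k + 1), A ((Fin.cons x w : Fin (k + 2) → V) i.castSucc)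
            ((Fin.cons x w : Fin (k + 2) → V) i.succ)) * g x (w (.last k))
        = ∑ w : Fin (k + 1) → V, (∏ i : Fin k, A (w i.castSucc) (w i.succ)) *
            (A x (w 0) * g x (w (.last k))) := by
          refine Finset.sum_congr rfl fun w _ ↦ ?_
          simp only [Fin.prod_univ_succ, Fin.castSucc_zero, Fin.cons_zero, Fin.cons_succ,
            ← Fin.succ_castSucc]
          ring
      _ = ∑ y, ∑ z, (A ^ k) y z * (A x y * g x z) := ih fun y z ↦ A x y * g x z
      _ = ∑ z, (A ^ (k + 1)) x z * g x z := by
          rw [Finset.sum_comm]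
          simp only [pow_succ', Matrix.mul_apply, Finset.sum_mul, mul_assoc, mul_left_comm (A x _)]

lemma trace_pow_eq_sum_prod (A : Matrix V V R) :
    (A ^ N).trace = ∑ w : Fin N → V, ∏ i, A (w i) (w (i + 1)) := by
  obtain ⟨k, rfl⟩ := Nat.exists_eq_succ_of_ne_zero (NeZero.ne N)
  calc (A ^ (k + 1)).trace = ∑ x, ∑ y, (A ^ k) x y * A y x := by
        simp [pow_succ, Matrix.trace, Matrix.mul_apply]
    _ = ∑ w : Fin (k + 1) → V, (∏ i : Fin k, A (w i.castSucc) (w i.succ)) * A (w (.last k)) (w 0) :=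
        (sum_prod_castSucc_succ_mul A k fun x y ↦ A y x).symm
    _ = ∑ w : Fin (k + 1) → V, ∏ i, A (w i) (w (i + 1)) := by
        simp [Fin.prod_univ_castSucc]

end TraceExpansion

section IdempotentProducts

variable {ι κ M : Type*} [DecidableEq ι] [CommMonoid M] {f : ι → M}

lemma prod_mul_prod_eq_prod_union (hf : ∀ e, IsIdempotentElem (f e)) (S T : Finset ι) :
    (∏ e ∈ S, f e) * ∏ e ∈ T, f e = ∏ e ∈ S ∪ T, f e := by
  have hinter : IsIdempotentElem (∏ e ∈ S ∩ T, f e) := by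
    rw [IsIdempotentElem, ← Finset.prod_mul_distrib]
    exact Finset.prod_congr rfl fun e _ ↦ hf e
  have hsub : S ∩ T ⊆ S ∪ T := Finset.inter_subset_union
  rw [← Finset.prod_union_inter, ← Finset.prod_sdiff hsub, mul_assoc, hinter.eq]

lemma prod_comp_eq_prod_image (hf : ∀ e, IsIdempotentElem (f e)) (s : Finset κ) (g : κ → ι) :
    ∏ i ∈ s, f (g i) = ∏ e ∈ s.image g, f e := by
  rw [Finset.prod_comp]
  refine Finset.prod_congr rfl fun e he ↦ (hf e).pow_eq ?_
  obtain ⟨i, hi, rfl⟩ := Finset.mem_image.1 he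
  exact Finset.card_ne_zero_of_mem (Finset.mem_filter.2 ⟨hi, rfl⟩)

end IdempotentProducts

section BernoulliFamily

variable {ι Ω : Type*} [MeasurableSpace Ω] {P : Measure Ω} {p : unitInterval} {ξ : ι → Ω → ℝ}

lemma ae_isIdempotentElem {X : Ω → ℝ} (h : HasLaw X (bernoulliMeasure (1 : ℝ) 0 p) P) :
    ∀ᵐ ω ∂P, IsIdempotentElem (X ω) := by
  have hmeas : MeasurableSet {x : ℝ | IsIdempotentElem x} :=
    measurableSet_eq_fun (by fun_prop) (by fun_prop)
  refine (h.ae_iff (p := IsIdempotentElem) (measurableSet_setOfPred.1 hmeas)).2 (ae_iff.2 ?_)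
  exact bernoulliMeasure_apply_of_notMem_of_notMem p hmeas.compl
    (by simp [IsIdempotentElem]) (by simp [IsIdempotentElem])

lemma integral_eq_of_hasLaw_bernoulliMeasure {X : Ω → ℝ}
    (h : HasLaw X (bernoulliMeasure (1 : ℝ) 0 p) P) : ∫ ω, X ω ∂P = p := by
  simp [h.integral_eq, integral_bernoulliMeasure]

lemma memLp_prod [Countable ι] [IsFiniteMeasure P]
    (hlaw : ∀ e, HasLaw (ξ e) (bernoulliMeasure (1 : ℝ) 0 p) P) (S : Finset ι) :
    MemLp (fun ω ↦ ∏ e ∈ S, ξ e ω) 2 P := by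
  refine .of_bound (C := 1)
    (S.aemeasurable_fun_prod fun e _ ↦ (hlaw e).aemeasurable).aestronglyMeasurable ?_
  filter_upwards [ae_all_iff.2 fun e ↦ ae_isIdempotentElem (hlaw e)] with ω hω
  rw [norm_prod]
  refine Finset.prod_le_one (fun _ _ ↦ norm_nonneg _) fun e _ ↦ ?_
  rcases IsIdempotentElem.iff_eq_zero_or_one.1 (hω e) with h | h <;> simp [h]

lemma memLp_of_hasLaw_bernoulliMeasure [IsFiniteMeasure P] {X : Ω → ℝ}
    (h : HasLaw X (bernoulliMeasure (1 : ℝ) 0 p) P) : MemLp X 2 P := by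
  simpa using memLp_prod (ξ := fun _ : Unit ↦ X) (fun _ ↦ h) {()}

lemma integral_prod_eq_pow_card (hlaw : ∀ e, HasLaw (ξ e) (bernoulliMeasure (1 : ℝ) 0 p) P)
    (hind : iIndepFun ξ P) (S : Finset ι) : ∫ ω, ∏ e ∈ S, ξ e ω ∂P = (p : ℝ) ^ #S := by
  have hprod := (hind.precomp (g := ((↑) : S → ι))
    Subtype.val_injective).integral_fun_prod_eq_prod_integral
    fun e ↦ (hlaw e).aemeasurable.aestronglyMeasurable
  simp only [integral_eq_of_hasLaw_bernoulliMeasure (hlaw _), Finset.prod_const, Finset.card_univ,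
    Fintype.card_coe] at hprod
  rw [← hprod]
  exact integral_congr_ae (ae_of_all _ fun ω ↦ (Finset.prod_coe_sort S (ξ · ω)).symm)

variable [Countable ι] [DecidableEq ι] [IsProbabilityMeasure P]

lemma covariance_prod_prod (hlaw : ∀ e, HasLaw (ξ e) (bernoulliMeasure (1 : ℝ) 0 p) P)
    (hind : iIndepFun ξ P) (S T : Finset ι) :
    cov[fun ω ↦ ∏ e ∈ S, ξ e ω, fun ω ↦ ∏ e ∈ T, ξ e ω; P] =
      (p : ℝ) ^ #(S ∪ T) - (p : ℝ) ^ (#S + #T) := by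
  rw [covariance_eq_sub (memLp_prod hlaw S) (memLp_prod hlaw T), pow_add]
  simp only [← integral_prod_eq_pow_card hlaw hind]
  congr 1
  refine integral_congr_ae ?_
  filter_upwards [ae_all_iff.2 fun e ↦ ae_isIdempotentElem (hlaw e)] with ω hω
  exact prod_mul_prod_eq_prod_union hω S T

lemma covariance_prod_prod_le (hlaw : ∀ e, HasLaw (ξ e) (bernoulliMeasure (1 : ℝ) 0 p) P)
    (hind : iIndepFun ξ P) (S T : Finset ι) :
    cov[fun ω ↦ ∏ e ∈ S, ξ e ω, fun ω ↦ ∏ e ∈ T, ξ e ω; P] ≤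
      (1 - p) * (#(S ∩ T) * (p : ℝ) ^ #(S ∪ T)) := by
  have hbernoulli : 1 + #(S ∩ T) * ((p : ℝ) - 1) ≤ (p : ℝ) ^ #(S ∩ T) := by
    simpa using one_add_mul_le_pow (show -2 ≤ (p : ℝ) - 1 by linarith [p.2.1]) #(S ∩ T)
  have hpow : 0 ≤ (p : ℝ) ^ #(S ∪ T) := pow_nonneg p.2.1 _
  rw [covariance_prod_prod hlaw hind, ← Finset.card_union_add_card_inter, pow_add]
  nlinarith

lemma covariance_prod_apply (hlaw : ∀ e, HasLaw (ξ e) (bernoulliMeasure (1 : ℝ) 0 p) P)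
    (hind : iIndepFun ξ P) (S : Finset ι) (e : ι) :
    cov[fun ω ↦ ∏ e ∈ S, ξ e ω, ξ e; P] = if e ∈ S then (1 - p) * (p : ℝ) ^ #S else 0 := by
  have hcov := covariance_prod_prod hlaw hind S {e}
  simp only [Finset.prod_singleton, Finset.card_singleton, Finset.union_singleton] at hcov
  rw [hcov]
  split_ifs with he
  · rw [Finset.insert_eq_of_mem he]
    ring
  · rw [Finset.card_insert_of_notMem he, sub_self]

omit [Countable ι] [DecidableEq ι] in
lemma variance_of_hasLaw_bernoulliMeasure {X : Ω → ℝ}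
    (h : HasLaw X (bernoulliMeasure (1 : ℝ) 0 p) P) : Var[X; P] = p * (1 - p) := by
  have hind : iIndepFun (fun _ : Unit ↦ X) P := iIndepFun.of_subsingleton
  have := covariance_prod_apply (fun _ : Unit ↦ h) hind {()} ()
  rw [← covariance_self h.aemeasurable]
  simpa [mul_comm] using this

end BernoulliFamily

section CharFun

lemma norm_prod_sub_prod_le_sum {ι R : Type*} [NormedCommRing R] [NormOneClass R]
    (s : Finset ι) {f g : ι → R} (hf : ∀ i, ‖f i‖ ≤ 1) (hg : ∀ i, ‖g i‖ ≤ 1) :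
    ‖∏ i ∈ s, f i - ∏ i ∈ s, g i‖ ≤ ∑ i ∈ s, ‖f i - g i‖ := by
  induction s using Finset.cons_induction with
  | empty => simp
  | cons i s hi ih =>
    have hprod : ‖∏ j ∈ s, g j‖ ≤ 1 :=
      (Finset.norm_prod_le s g).trans (Finset.prod_le_one (fun _ _ ↦ norm_nonneg _) fun j _ ↦ hg j)
    rw [Finset.prod_cons, Finset.prod_cons, Finset.sum_cons]
    calc ‖f i * ∏ j ∈ s, f j - g i * ∏ j ∈ s, g j‖
        = ‖(f i - g i) * ∏ j ∈ s, g j + f i * (∏ j ∈ s, f j - ∏ j ∈ s, g j)‖ := by ring_nf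
      _ ≤ ‖f i - g i‖ * ‖∏ j ∈ s, g j‖ + ‖f i‖ * ‖∏ j ∈ s, f j - ∏ j ∈ s, g j‖ :=
          (norm_add_le _ _).trans (add_le_add (norm_mul_le _ _) (norm_mul_le _ _))
      _ ≤ ‖f i - g i‖ * 1 + 1 * ∑ j ∈ s, ‖f j - g j‖ := by
          gcongr
          exact hf i
      _ = _ := by ring

lemma norm_exp_mul_I_sub_le (x : ℝ) :
    ‖Complex.exp (x * Complex.I) - (1 + x * Complex.I - x ^ 2 / 2)‖ ≤ |x| ^ 3 * Real.exp |x| := by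
  have h := Complex.norm_exp_sub_sum_le_norm_mul_exp (x * Complex.I) 3
  rw [show ‖(x : ℂ) * Complex.I‖ = |x| by simp] at h
  convert h using 3
  simp only [Finset.sum_range_succ, Finset.sum_range_zero, Nat.factorial, mul_pow, Complex.I_sq]
  push_cast
  ring

lemma norm_exp_neg_sub_le {x : ℝ} (hx : 0 ≤ x) :
    ‖Complex.exp (-x : ℝ) - (1 - x)‖ ≤ x ^ 2 * Real.exp x := by
  have h := Complex.norm_exp_sub_sum_le_norm_mul_exp ((-x : ℝ) : ℂ) 2
  rw [Complex.norm_real, norm_neg, Real.norm_of_nonneg hx] at h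
  convert h using 3
  simp [Finset.sum_range_succ, sub_eq_add_neg]

variable {Ω : Type*} [MeasurableSpace Ω] {P : Measure Ω} [IsProbabilityMeasure P]

lemma integrable_exp_mul_I {X : Ω → ℝ} (hX : AEMeasurable X P) :
    Integrable (fun ω ↦ Complex.exp (X ω * Complex.I)) P :=
  .of_bound (C := 1) (by fun_prop) (ae_of_all _ fun ω ↦ (Complex.norm_exp_ofReal_mul_I _).le)

omit [IsProbabilityMeasure P] in
lemma charFun_map_eq_integral {X : Ω → ℝ} (hX : AEMeasurable X P) (t : ℝ) :
    charFun (P.map X) t = ∫ ω, Complex.exp ((t * X ω : ℝ) * Complex.I) ∂P := by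
  rw [charFun_apply_real, integral_map hX (by fun_prop)]
  simp

lemma norm_charFun_map_sub_le {X Y : Ω → ℝ} (hX : MemLp X 2 P) (hY : MemLp Y 2 P) (t : ℝ) :
    ‖charFun (P.map X) t - charFun (P.map Y) t‖ ≤ |t| * √(∫ ω, (X ω - Y ω) ^ 2 ∂P) := by
  have hXm := hX.aestronglyMeasurable.aemeasurable
  have hYm := hY.aestronglyMeasurable.aemeasurable
  have habs : MemLp (fun ω ↦ |X ω - Y ω|) 2 P := (hX.sub hY).abs
  have hlip : ∀ x y : ℝ, ‖Complex.exp ((t * x : ℝ) * Complex.I) -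
      Complex.exp ((t * y : ℝ) * Complex.I)‖ ≤ |t| * |x - y| := fun x y ↦
    calc ‖Complex.exp ((t * x : ℝ) * Complex.I) - Complex.exp ((t * y : ℝ) * Complex.I)‖
        = ‖Complex.exp ((t * y : ℝ) * Complex.I) *
            (Complex.exp (Complex.I * (t * (x - y) : ℝ)) - 1)‖ := by
          rw [mul_sub, ← Complex.exp_add, mul_one]
          push_cast
          ring_nf
      _ ≤ |t| * |x - y| := by
          rw [norm_mul, Complex.norm_exp_ofReal_mul_I, one_mul, ← abs_mul]
          exact Real.norm_exp_I_mul_ofReal_sub_one_le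
  have hjensen : ∫ ω, |X ω - Y ω| ∂P ≤ √(∫ ω, (X ω - Y ω) ^ 2 ∂P) := by
    have hvar := variance_nonneg (fun ω ↦ |X ω - Y ω|) P
    rw [variance_eq_sub habs] at hvar
    simp only [Pi.pow_apply, sq_abs] at hvar
    exact Real.le_sqrt_of_sq_le (by linarith)
  rw [charFun_map_eq_integral hXm, charFun_map_eq_integral hYm,
    ← integral_sub (integrable_exp_mul_I (hXm.const_mul t))
      (integrable_exp_mul_I (hYm.const_mul t))]
  calc ‖∫ ω, (Complex.exp ((t * X ω : ℝ) * Complex.I) -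
          Complex.exp ((t * Y ω : ℝ) * Complex.I)) ∂P‖
      ≤ ∫ ω, |t| * |X ω - Y ω| ∂P :=
        norm_integral_le_of_norm_le ((habs.integrable one_le_two).const_mul _)
          (ae_of_all _ fun ω ↦ hlip (X ω) (Y ω))
    _ ≤ |t| * √(∫ ω, (X ω - Y ω) ^ 2 ∂P) := by
        rw [integral_const_mul]
        gcongr

lemma norm_integral_exp_mul_I_sub_le {X : Ω → ℝ} (hX : AEMeasurable X P)
    (hmean : ∫ ω, X ω ∂P = 0) {B : ℝ} (hB : ∀ᵐ ω ∂P, |X ω| ≤ B) :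
    ‖∫ ω, Complex.exp (X ω * Complex.I) ∂P - (1 - Var[X; P] / 2)‖ ≤
      Var[X; P] * (B * Real.exp B) := by
  have hLp : MemLp X 2 P := .of_bound hX.aestronglyMeasurable B hB
  have hvar : Var[X; P] = ∫ ω, X ω ^ 2 ∂P := by simp [variance_eq_integral hX, hmean]
  have hlin_int : Integrable (fun ω ↦ X ω * Complex.I) P :=
    (hLp.integrable one_le_two).ofReal.mul_const Complex.I
  have hsq_int : Integrable (fun ω ↦ (X ω : ℂ) ^ 2 / 2) P := by
    simpa using (hLp.integrable_sq.ofReal (𝕜 := ℂ)).div_const 2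
  have hone_add_int : Integrable (fun ω ↦ 1 + X ω * Complex.I) P :=
    (integrable_const 1).add hlin_int
  have htaylor_int : Integrable (fun ω ↦ (1 + X ω * Complex.I - X ω ^ 2 / 2 : ℂ)) P :=
    hone_add_int.sub hsq_int
  have htaylor : ∫ ω, (1 + X ω * Complex.I - X ω ^ 2 / 2 : ℂ) ∂P = 1 - Var[X; P] / 2 := by
    rw [integral_sub hone_add_int hsq_int, integral_add (integrable_const 1) hlin_int,
      integral_mul_const, integral_complex_ofReal, hmean, integral_div, hvar]
    simp [← integral_complex_ofReal]
  rw [← htaylor, ← integral_sub (integrable_exp_mul_I hX) htaylor_int, hvar,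
    ← integral_mul_const]
  refine norm_integral_le_of_norm_le (hLp.integrable_sq.mul_const _) ?_
  filter_upwards [hB] with ω hω
  have hB_nonneg : 0 ≤ B := (abs_nonneg _).trans hω
  calc ‖Complex.exp (X ω * Complex.I) - (1 + X ω * Complex.I - X ω ^ 2 / 2)‖
      ≤ X ω ^ 2 * (|X ω| * Real.exp |X ω|) := by
        refine (norm_exp_mul_I_sub_le (X ω)).trans_eq ?_
        rw [← sq_abs (X ω)]
        ring
    _ ≤ X ω ^ 2 * (B * Real.exp B) := by gcongr

lemma norm_integral_exp_mul_I_sub_exp_le {X : Ω → ℝ} (hX : AEMeasurable X P)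
    (hmean : ∫ ω, X ω ∂P = 0) {B : ℝ} (hB : ∀ᵐ ω ∂P, |X ω| ≤ B) :
    ‖∫ ω, Complex.exp (X ω * Complex.I) ∂P - Complex.exp (-(Var[X; P] / 2) : ℝ)‖ ≤
      Var[X; P] * (B * Real.exp B + B ^ 2 * Real.exp (B ^ 2)) := by
  have hvar : Var[X; P] ≤ B ^ 2 := by
    simpa using variance_le_sq_of_bounded (hB.mono fun ω hω ↦ abs_le.1 hω) hX
  have hvar_nonneg := variance_nonneg X P
  have hexp : (Var[X; P] / 2) ^ 2 * Real.exp (Var[X; P] / 2) ≤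
      Var[X; P] * (B ^ 2 * Real.exp (B ^ 2)) :=
    calc (Var[X; P] / 2) ^ 2 * Real.exp (Var[X; P] / 2)
        = Var[X; P] / 2 * (Var[X; P] / 2 * Real.exp (Var[X; P] / 2)) := by ring
      _ ≤ Var[X; P] * (B ^ 2 * Real.exp (B ^ 2)) := by gcongr <;> linarith
  calc ‖∫ ω, Complex.exp (X ω * Complex.I) ∂P - Complex.exp (-(Var[X; P] / 2) : ℝ)‖
      ≤ ‖∫ ω, Complex.exp (X ω * Complex.I) ∂P - (1 - Var[X; P] / 2)‖ +
          ‖Complex.exp (-(Var[X; P] / 2) : ℝ) - (1 - Var[X; P] / 2)‖ := by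
        rw [norm_sub_rev (Complex.exp _)]
        exact norm_sub_le_norm_sub_add_norm_sub _ _ _
    _ ≤ Var[X; P] * (B * Real.exp B) + Var[X; P] * (B ^ 2 * Real.exp (B ^ 2)) := by
        have hneg := norm_exp_neg_sub_le (div_nonneg hvar_nonneg zero_le_two)
        push_cast at hneg ⊢
        exact add_le_add (norm_integral_exp_mul_I_sub_le hX hmean hB) (hneg.trans hexp)
    _ = _ := by ring

lemma norm_charFun_map_sub_exp_le {X : Ω → ℝ} (hX : AEMeasurable X P) (hmean : ∫ ω, X ω ∂P = 0)
    {B : ℝ} (hB : ∀ᵐ ω ∂P, |X ω| ≤ B) (t : ℝ) :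
    ‖charFun (P.map X) t - Complex.exp (-(t ^ 2 * Var[X; P] / 2) : ℝ)‖ ≤
      t ^ 2 * Var[X; P] *
        (|t| * B * Real.exp (|t| * B) + (|t| * B) ^ 2 * Real.exp ((|t| * B) ^ 2)) := by
  rw [charFun_map_eq_integral hX, ← variance_const_mul]
  refine norm_integral_exp_mul_I_sub_exp_le (hX.const_mul t)
    (by rw [integral_const_mul, hmean, mul_zero]) ?_
  filter_upwards [hB] with ω hω
  rw [abs_mul]
  gcongr

lemma norm_charFun_map_sum_sub_exp_le {κ : Type*} [Fintype κ] {X : κ → Ω → ℝ}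
    (hX : ∀ e, AEMeasurable (X e) P) (hind : iIndepFun X P) (hmean : ∀ e, ∫ ω, X e ω ∂P = 0)
    {B : ℝ} (hB : ∀ e, ∀ᵐ ω ∂P, |X e ω| ≤ B) (t : ℝ) :
    ‖charFun (P.map fun ω ↦ ∑ e, X e ω) t -
        Complex.exp (-(t ^ 2 * (∑ e, Var[X e; P]) / 2) : ℝ)‖ ≤
      t ^ 2 * (∑ e, Var[X e; P]) *
        (|t| * B * Real.exp (|t| * B) + (|t| * B) ^ 2 * Real.exp ((|t| * B) ^ 2)) := by
  have hexp : Complex.exp (-(t ^ 2 * (∑ e, Var[X e; P]) / 2) : ℝ) =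
      ∏ e, Complex.exp (-(t ^ 2 * Var[X e; P] / 2) : ℝ) := by
    rw [← Complex.exp_sum, ← Complex.ofReal_sum, Finset.sum_neg_distrib, Finset.mul_sum,
      Finset.sum_div]
  have hnorm : ∀ e, ‖Complex.exp (-(t ^ 2 * Var[X e; P] / 2) : ℝ)‖ ≤ 1 := fun e ↦ by
    have := variance_nonneg (X e) P
    rw [Complex.norm_exp, Complex.ofReal_re, Real.exp_le_one_iff, neg_nonpos]
    positivity
  rw [hind.charFun_map_fun_sum_eq_prod hX, Finset.prod_apply, hexp, Finset.mul_sum, Finset.sum_mul]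
  have := fun e ↦ Measure.isProbabilityMeasure_map (hX e)
  exact (norm_prod_sub_prod_le_sum _ (fun e ↦ norm_charFun_le_one t) hnorm).trans
    (Finset.sum_le_sum fun e _ ↦ norm_charFun_map_sub_exp_le (hX e) (hmean e) (hB e) t)

end CharFun

section ConvergenceInDistribution

variable {Ω' : Type*} {Ω : ℕ → Type*} [∀ n, MeasurableSpace (Ω n)] {P : ∀ n, Measure (Ω n)}
  [∀ n, IsProbabilityMeasure (P n)]

lemma tendstoInDistribution_iff_tendsto_charFun [MeasurableSpace Ω'] {μ : Measure Ω'}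
    [IsProbabilityMeasure μ] {X : ∀ n, Ω n → ℝ} {Z : Ω' → ℝ} (hX : ∀ n, AEMeasurable (X n) (P n))
    (hZ : AEMeasurable Z μ) :
    TendstoInDistribution X atTop Z P μ ↔
      ∀ t, Tendsto (fun n ↦ charFun ((P n).map (X n)) t) atTop (𝓝 (charFun (μ.map Z) t)) :=
  ⟨fun h ↦ ProbabilityMeasure.tendsto_iff_tendsto_charFun.1 h.tendsto, fun h ↦
    ⟨hX, hZ, ProbabilityMeasure.tendsto_iff_tendsto_charFun.2 h⟩⟩

lemma tendstoInDistribution_of_tendsto_integral_sub_sq [MeasurableSpace Ω'] {μ : Measure Ω'}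
    [IsProbabilityMeasure μ] {X Y : ∀ n, Ω n → ℝ} {Z : Ω' → ℝ} (hX : ∀ n, MemLp (X n) 2 (P n))
    (hY : ∀ n, MemLp (Y n) 2 (P n)) (hYZ : TendstoInDistribution Y atTop Z P μ)
    (hXY : Tendsto (fun n ↦ ∫ ω, (X n ω - Y n ω) ^ 2 ∂(P n)) atTop (𝓝 0)) :
    TendstoInDistribution X atTop Z P μ := by
  have hXm := fun n ↦ (hX n).aestronglyMeasurable.aemeasurable
  rw [tendstoInDistribution_iff_tendsto_charFun hXm hYZ.aemeasurable_limit]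
  intro t
  have hlim : Tendsto (fun n ↦ |t| * √(∫ ω, (X n ω - Y n ω) ^ 2 ∂(P n))) atTop (𝓝 0) := by
    simpa using hXY.sqrt.const_mul |t|
  have hdiff := squeeze_zero_norm (fun n ↦ norm_charFun_map_sub_le (hX n) (hY n) t) hlim
  have hYt := (tendstoInDistribution_iff_tendsto_charFun hYZ.forall_aemeasurable
    hYZ.aemeasurable_limit).1 hYZ t
  simpa using hdiff.add hYt

theorem tendstoInDistribution_sum_gaussianReal {κ : ℕ → Type*} [∀ n, Fintype (κ n)]
    {X : ∀ n, κ n → Ω n → ℝ} (hX : ∀ n e, AEMeasurable (X n e) (P n))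
    (hind : ∀ n, iIndepFun (X n) (P n)) (hmean : ∀ n e, ∫ ω, X n e ω ∂(P n) = 0) {B : ℕ → ℝ}
    (hB : ∀ n e, ∀ᵐ ω ∂(P n), |X n e ω| ≤ B n) (hB_lim : Tendsto B atTop (𝓝 0)) {v : NNReal}
    (hv : Tendsto (fun n ↦ ∑ e, Var[X n e; P n]) atTop (𝓝 v)) :
    TendstoInDistribution (fun n ω ↦ ∑ e, X n e ω) atTop (id : ℝ → ℝ) P (gaussianReal 0 v) := by
  rw [tendstoInDistribution_iff_tendsto_charFun
    (fun n ↦ Finset.univ.aemeasurable_fun_sum fun e _ ↦ hX n e) aemeasurable_id]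
  intro t
  have hgauss : Tendsto (fun n ↦ Complex.exp (-(t ^ 2 * (∑ e, Var[X n e; P n]) / 2) : ℝ)) atTop
      (𝓝 (charFun ((gaussianReal 0 v).map id) t)) := by
    have hcont : Continuous fun x : ℝ ↦ Complex.exp (-(t ^ 2 * x / 2) : ℝ) := by fun_prop
    have hval : charFun ((gaussianReal 0 v).map id) t = Complex.exp (-(t ^ 2 * v / 2) : ℝ) := by
      rw [Measure.map_id, charFun_gaussianReal]
      push_cast
      ring_nf
    rw [hval]
    exact (hcont.tendsto _).comp hv
  have herror : Tendsto (fun n ↦ t ^ 2 * (∑ e, Var[X n e; P n]) * (|t| * B n *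
      Real.exp (|t| * B n) + (|t| * B n) ^ 2 * Real.exp ((|t| * B n) ^ 2))) atTop (𝓝 0) := by
    have hcont : Continuous fun b : ℝ ↦
      |t| * b * Real.exp (|t| * b) + (|t| * b) ^ 2 * Real.exp ((|t| * b) ^ 2) := by fun_prop
    simpa using (hv.const_mul (t ^ 2)).mul ((hcont.tendsto 0).comp hB_lim)
  have hdiff := squeeze_zero_norm (fun n ↦ norm_charFun_map_sum_sub_exp_le (hX n) (hind n)
    (hmean n) (hB n) t) herror
  simpa using hdiff.add hgauss

end ConvergenceInDistribution

section WalkMonomials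

variable {ι W Ω : Type*} [Fintype W] [MeasurableSpace Ω]
  {P : Measure Ω} [IsProbabilityMeasure P] {p : unitInterval} {ξ : ι → Ω → ℝ}

lemma variance_sum_prod_le [DecidableEq ι] [Countable ι]
    (hlaw : ∀ e, HasLaw (ξ e) (bernoulliMeasure (1 : ℝ) 0 p) P)
    (hind : iIndepFun ξ P) (E : W → Finset ι) :
    Var[fun ω ↦ ∑ w, ∏ e ∈ E w, ξ e ω; P] ≤
      (1 - p) * ∑ w, ∑ w', #(E w ∩ E w') * (p : ℝ) ^ #(E w ∪ E w') := by
  rw [variance_fun_sum fun w ↦ memLp_prod hlaw (E w)]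
  simp only [Finset.mul_sum]
  exact Finset.sum_le_sum fun w _ ↦ Finset.sum_le_sum fun w' _ ↦
    covariance_prod_prod_le hlaw hind (E w) (E w')

lemma covariance_sum_prod_sum [Fintype ι]
    (hlaw : ∀ e, HasLaw (ξ e) (bernoulliMeasure (1 : ℝ) 0 p) P) (hind : iIndepFun ξ P)
    (E : W → Finset ι) :
    cov[fun ω ↦ ∑ w, ∏ e ∈ E w, ξ e ω, fun ω ↦ ∑ e, ξ e ω; P] =
      (1 - p) * ∑ w, #(E w) * (p : ℝ) ^ #(E w) := by
  classical
  rw [covariance_fun_sum_fun_sum (fun w ↦ memLp_prod hlaw (E w))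
    fun e ↦ memLp_of_hasLaw_bernoulliMeasure (hlaw e)]
  simp only [covariance_prod_apply hlaw hind, Finset.sum_ite_mem, Finset.univ_inter,
    Finset.sum_const, nsmul_eq_mul, Finset.mul_sum]
  exact Finset.sum_congr rfl fun w _ ↦ by ring

lemma variance_sum_eq_card_mul [Fintype ι]
    (hlaw : ∀ e, HasLaw (ξ e) (bernoulliMeasure (1 : ℝ) 0 p) P) (hind : iIndepFun ξ P) :
    Var[fun ω ↦ ∑ e, ξ e ω; P] = Fintype.card ι * (p * (1 - p)) := by
  have hmem : MemLp (fun ω ↦ ∑ e, ξ e ω) 2 P :=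
    memLp_finsetSum _ fun e _ ↦ memLp_of_hasLaw_bernoulliMeasure (hlaw e)
  have hcov := covariance_sum_prod_sum hlaw hind fun e : ι ↦ {e}
  simp only [Finset.prod_singleton, covariance_self hmem.aemeasurable, Finset.card_singleton,
    Nat.cast_one, one_mul, pow_one, Finset.sum_const, Finset.card_univ, nsmul_eq_mul] at hcov
  linarith

end WalkMonomials

section Matrix

variable {Ω : Type*} [MeasurableSpace Ω] {P : Measure Ω} {n : ℕ}
  {p : unitInterval} {A : Ω → Matrix (Fin n) (Fin n) ℝ}

/-- The entry of a random symmetric matrix at an unordered pair of indices, read off on or above the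
diagonal, where the entries are known to be independent. -/
def symmEntry (A : Ω → Matrix (Fin n) (Fin n) ℝ) (e : Sym2 (Fin n)) (ω : Ω) : ℝ :=
  A ω (Sym2.sortEquiv e).1.1 (Sym2.sortEquiv e).1.2

namespace IsSymmBernoulliMatrix

lemma apply_eq_symmEntry (hA : IsSymmBernoulliMatrix P p A) (ω : Ω) (i j : Fin n) :
    A ω i j = symmEntry A s(i, j) ω := by
  simp only [symmEntry, Sym2.sortEquiv, Equiv.coe_fn_mk, Sym2.inf_mk, Sym2.sup_mk]
  rcases le_total i j with h | h
  · simp [h]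
  · simp [h, (hA.isSymm ω).apply i j]

lemma hasLaw_symmEntry (hA : IsSymmBernoulliMatrix P p A) (e : Sym2 (Fin n)) :
    HasLaw (symmEntry A e) (bernoulliMeasure (1 : ℝ) 0 p) P :=
  hA.hasLaw _ _ (Sym2.sortEquiv e).2

lemma iIndepFun_symmEntry (hA : IsSymmBernoulliMatrix P p A) :
    ProbabilityTheory.iIndepFun (symmEntry A) P :=
  hA.iIndepFun.precomp (g := Sym2.sortEquiv) Sym2.sortEquiv.injective

lemma trace_pow_ae_eq (hA : IsSymmBernoulliMatrix P p A) (N : ℕ) [NeZero N] :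
    (fun ω ↦ (A ω ^ N).trace) =ᵐ[P]
      fun ω ↦ ∑ w : Fin N → Fin n, ∏ e ∈ closedWalkEdges w, symmEntry A e ω := by
  filter_upwards [ae_all_iff.2 fun e ↦ ae_isIdempotentElem (hA.hasLaw_symmEntry e)] with ω hω
  rw [trace_pow_eq_sum_prod]
  simp only [hA.apply_eq_symmEntry ω]
  exact Finset.sum_congr rfl fun w _ ↦
    prod_comp_eq_prod_image hω Finset.univ fun i ↦ s(w i, w (i + 1))

end IsSymmBernoulliMatrix

end Matrix

section LinearStatistic

variable {Ω : Type*} [MeasurableSpace Ω] {P : Measure Ω} {n : ℕ}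
  {p : unitInterval} {A : Ω → Matrix (Fin n) (Fin n) ℝ}

/-- The centered sum of the entries on and above the diagonal, scaled so that its variance tends to
`2`. It is the part of `normalizedTrace` which is linear in the entries. -/
noncomputable def linearStatistic (p : ℝ) (A : Ω → Matrix (Fin n) (Fin n) ℝ) (ω : Ω) : ℝ :=
  ∑ e, 2 / (n * √(p * (1 - p))) * (symmEntry A e ω - p)

lemma covariance_congr_ae_left {X X' Y : Ω → ℝ} (h : X =ᵐ[P] X') :
    cov[X, Y; P] = cov[X', Y; P] := by
  simp only [covariance, integral_congr_ae h]
  exact integral_congr_ae (h.mono fun ω hω ↦ by simp only [hω])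

lemma variance_const_mul_sub_const_mul [IsFiniteMeasure P] {X Y : Ω → ℝ} (hX : MemLp X 2 P)
    (hY : MemLp Y 2 P) (a b : ℝ) :
    Var[fun ω ↦ a * X ω - b * Y ω; P] =
      a ^ 2 * Var[X; P] - 2 * a * b * cov[X, Y; P] + b ^ 2 * Var[Y; P] := by
  rw [variance_fun_sub (hX.const_mul a) (hY.const_mul b), variance_const_mul, variance_const_mul,
    covariance_const_mul_left, covariance_const_mul_right]
  ring

lemma card_sym2_fin (n : ℕ) : (Fintype.card (Sym2 (Fin n)) : ℝ) = n * (n + 1) / 2 := by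
  rw [Sym2.card, Fintype.card_fin, Nat.cast_choose_two]
  push_cast
  ring

namespace IsSymmBernoulliMatrix

lemma integral_symmEntry (hA : IsSymmBernoulliMatrix P p A) (e : Sym2 (Fin n)) :
    ∫ ω, symmEntry A e ω ∂P = p :=
  integral_eq_of_hasLaw_bernoulliMeasure (hA.hasLaw_symmEntry e)

lemma ae_abs_symmEntry_sub_le_one (hA : IsSymmBernoulliMatrix P p A) (e : Sym2 (Fin n)) :
    ∀ᵐ ω ∂P, |symmEntry A e ω - p| ≤ 1 := by
  filter_upwards [ae_isIdempotentElem (hA.hasLaw_symmEntry e)] with ω hω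
  obtain ⟨hp0, hp1⟩ := p.2
  rcases IsIdempotentElem.iff_eq_zero_or_one.1 hω with h | h <;>
    exact abs_le.2 ⟨by linarith, by linarith⟩

variable [IsProbabilityMeasure P]

lemma memLp_symmEntry (hA : IsSymmBernoulliMatrix P p A) (e : Sym2 (Fin n)) :
    MemLp (symmEntry A e) 2 P :=
  memLp_of_hasLaw_bernoulliMeasure (hA.hasLaw_symmEntry e)

lemma variance_symmEntry (hA : IsSymmBernoulliMatrix P p A) (e : Sym2 (Fin n)) :
    Var[symmEntry A e; P] = p * (1 - p) :=
  variance_of_hasLaw_bernoulliMeasure (hA.hasLaw_symmEntry e)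

lemma sum_variance_const_mul_symmEntry_sub (hA : IsSymmBernoulliMatrix P p A) (hn : n ≠ 0)
    (hp : 0 < (p : ℝ) * (1 - p)) :
    ∑ e, Var[fun ω ↦ 2 / (n * √(p * (1 - p) : ℝ)) * (symmEntry A e ω - p); P] = 2 + 2 / n := by
  simp only [variance_const_mul,
    variance_sub_const (hA.memLp_symmEntry _).aestronglyMeasurable, hA.variance_symmEntry,
    Finset.sum_const, Finset.card_univ, nsmul_eq_mul, card_sym2_fin, div_pow, mul_pow,
    Real.sq_sqrt hp.le]
  set q : ℝ := p * (1 - p)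
  field_simp

lemma memLp_sum_symmEntry (hA : IsSymmBernoulliMatrix P p A) :
    MemLp (fun ω ↦ ∑ e, symmEntry A e ω) 2 P :=
  memLp_finsetSum _ fun e _ ↦ hA.memLp_symmEntry e

lemma memLp_linearStatistic (hA : IsSymmBernoulliMatrix P p A) (r : ℝ) :
    MemLp (linearStatistic r A) 2 P :=
  memLp_finsetSum _ fun e _ ↦ ((hA.memLp_symmEntry e).sub (memLp_const r)).const_mul _

lemma memLp_trace_pow (hA : IsSymmBernoulliMatrix P p A) (N : ℕ) :
    MemLp (fun ω ↦ (A ω ^ N).trace) 2 P := by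
  rcases N.eq_zero_or_pos with rfl | hN
  · simpa using memLp_const (n : ℝ)
  · have : NeZero N := ⟨hN.ne'⟩
    exact (memLp_congr_ae (hA.trace_pow_ae_eq N)).2
      (memLp_finsetSum _ fun w _ ↦ memLp_prod hA.hasLaw_symmEntry _)

lemma memLp_normalizedTrace (hA : IsSymmBernoulliMatrix P p A) (r : ℝ) (m : ℕ) :
    MemLp (normalizedTrace P r m A) 2 P :=
  ((hA.memLp_trace_pow (2 * m)).sub
    (memLp_const (∫ ω, (A ω ^ (2 * m)).trace ∂P))).mul_const
    (2 * m * (n * r) ^ (2 * m - 1) * √(r * (1 - r)))⁻¹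

lemma variance_trace_pow_le (hA : IsSymmBernoulliMatrix P p A) {N d : ℕ} (hN : 3 ≤ N)
    (hd : 4 * d ≤ N + 3) (hp : 0 < (p : ℝ)) (h : (2 * N : ℝ) ^ 2 ≤ n * p) :
    Var[fun ω ↦ (A ω ^ N).trace; P] ≤ (N * (n * p) ^ (N - 1)) ^ 2 * (p * (1 - p)) *
      (2 + 3 * ((2 * N) ^ 6 / (n * p) + n ^ 2 * ((2 * N) ^ 2 / (n * p)) ^ d)) := by
  have : NeZero N := ⟨by omega⟩
  have hq : (0 : ℝ) ≤ 1 - p := sub_nonneg.2 p.2.2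
  have hN1 : (1 : ℝ) ≤ N := by exact_mod_cast (by omega : 1 ≤ N)
  have hsum := sum_card_inter_mul_pow_card_union_le (V := Fin n) hN hd hp p.2.2
    (by rwa [Fintype.card_fin])
  rw [Fintype.card_fin] at hsum
  have hnp : (0 : ℝ) < n * p := lt_of_lt_of_le (by positivity) h
  rw [variance_congr (hA.trace_pow_ae_eq N)]
  refine (variance_sum_prod_le hA.hasLaw_symmEntry hA.iIndepFun_symmEntry _).trans
    ((mul_le_mul_of_nonneg_left hsum hq).trans ?_)
  have hexp1 : 2 * N - 2 = 2 * (N - 1) := by omega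
  have hexp2 : 2 * N - 1 = 2 * (N - 1) + 1 := by omega
  have hexp3 : 2 * N = 2 * (N - 1) + 2 := by omega
  rw [hexp2, hexp1, hexp3]
  set θ : ℝ := (2 * N) ^ 2 / (n * p)
  set R : ℝ := (2 * N) ^ 6 / (n * p) + n ^ 2 * θ ^ d with hR
  have hθ : (2 * N : ℝ) ^ 6 / (n * p) = (n * p : ℝ) ^ 2 * θ ^ 3 := by
    simp only [θ]
    field_simp
  calc _ = ((n * p : ℝ) ^ (N - 1)) ^ 2 * (p * (1 - p)) * (N ^ 2 * 2 + N * (3 * R)) := by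
        rw [hR, hθ]
        field_simp
        ring
    _ ≤ ((n * p : ℝ) ^ (N - 1)) ^ 2 * (p * (1 - p)) * (N ^ 2 * 2 + N ^ 2 * (3 * R)) := by
        gcongr
        exact le_self_pow₀ hN1 two_ne_zero
    _ = _ := by ring

lemma le_covariance_trace_pow_sum (hA : IsSymmBernoulliMatrix P p A) {N : ℕ} (hN : 3 ≤ N)
    (hNn : N ≤ n) :
    N * (n * p : ℝ) ^ (N - 1) * (p * (1 - p)) * (n - N ^ 2) ≤
      cov[fun ω ↦ (A ω ^ N).trace, fun ω ↦ ∑ e, symmEntry A e ω; P] := by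
  have : NeZero N := ⟨by omega⟩
  have hn : (n : ℝ) ≠ 0 := by exact_mod_cast (by omega : n ≠ 0)
  have hq : (0 : ℝ) ≤ 1 - p := sub_nonneg.2 p.2.2
  have hsum := le_sum_card_mul_pow_card_closedWalkEdges (V := Fin n) hN
    (by rwa [Fintype.card_fin]) p.2.1
  rw [Fintype.card_fin] at hsum
  rw [covariance_congr_ae_left (hA.trace_pow_ae_eq N),
    covariance_sum_prod_sum hA.hasLaw_symmEntry hA.iIndepFun_symmEntry]
  refine le_trans (le_of_eq ?_) (mul_le_mul_of_nonneg_left hsum hq)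
  obtain ⟨k, rfl⟩ : ∃ k, N = k + 1 := ⟨N - 1, by omega⟩
  simp only [Nat.add_sub_cancel, mul_pow]
  field_simp
  ring

lemma variance_sum_symmEntry (hA : IsSymmBernoulliMatrix P p A) :
    Var[fun ω ↦ ∑ e, symmEntry A e ω; P] = (n : ℝ) * (n + 1) / 2 * (p * (1 - p)) := by
  rw [variance_sum_eq_card_mul hA.hasLaw_symmEntry hA.iIndepFun_symmEntry, card_sym2_fin]

lemma integral_normalizedTrace_sub_linearStatistic_sq (hA : IsSymmBernoulliMatrix P p A) (m : ℕ) :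
    ∫ ω, (normalizedTrace P p m A ω - linearStatistic p A ω) ^ 2 ∂P =
      Var[fun ω ↦ (2 * m * (n * p : ℝ) ^ (2 * m - 1) * √(p * (1 - p)))⁻¹ * (A ω ^ (2 * m)).trace -
        2 / (n * √(p * (1 - p) : ℝ)) * ∑ e, symmEntry A e ω; P] := by
  have htr := (hA.memLp_trace_pow (2 * m)).const_mul
    (2 * m * (n * p : ℝ) ^ (2 * m - 1) * √(p * (1 - p)))⁻¹
  have hlin := hA.memLp_sum_symmEntry.const_mul (2 / (n * √(p * (1 - p) : ℝ)))
  have hmeas : AEMeasurable (fun ω ↦ (2 * m * (n * p : ℝ) ^ (2 * m - 1) *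
      √(p * (1 - p)))⁻¹ * (A ω ^ (2 * m)).trace -
        2 / (n * √(p * (1 - p) : ℝ)) * ∑ e, symmEntry A e ω) P := (htr.sub hlin).aemeasurable
  rw [variance_eq_integral hmeas, integral_sub (htr.integrable one_le_two)
    (hlin.integrable one_le_two), integral_const_mul, integral_const_mul,
    integral_finsetSum _ fun e _ ↦ (hA.memLp_symmEntry e).integrable one_le_two]
  simp only [hA.integral_symmEntry, normalizedTrace, linearStatistic, ← Finset.mul_sum,
    Finset.sum_sub_distrib]
  congr 1 with ω
  ring

lemma integral_normalizedTrace_sub_linearStatistic_sq_le (hA : IsSymmBernoulliMatrix P p A)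
    {m d : ℕ} (hm : 2 ≤ m) (hd : 4 * d ≤ 2 * m + 3) (hp : 0 < (p : ℝ)) (hp1 : (p : ℝ) < 1)
    (h : (4 * m : ℝ) ^ 2 ≤ n * p) :
    ∫ ω, (normalizedTrace P p m A ω - linearStatistic p A ω) ^ 2 ∂P ≤
      3 * ((4 * m) ^ 6 / (n * p) + n ^ 2 * ((4 * m) ^ 2 / (n * p)) ^ d) + (16 * m ^ 2 + 2) / n := by
  have hm1 : (1 : ℝ) ≤ m := by exact_mod_cast (by omega : 1 ≤ m)
  have hnp : (0 : ℝ) < n * p := lt_of_lt_of_le (by positivity) h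
  have hn : (0 : ℝ) < n := pos_of_mul_pos_left hnp hp.le
  have hNn : 2 * m ≤ n := by
    have : (2 * m : ℝ) ≤ n := by nlinarith
    exact_mod_cast this
  have hN : ((2 * m : ℕ) : ℝ) = 2 * m := by push_cast; rfl
  have h4 : 2 * (2 * (m : ℝ)) = 4 * m := by ring
  have hvar := hA.variance_trace_pow_le (N := 2 * m) (by omega) hd hp (by rwa [hN, h4])
  have hcov := hA.le_covariance_trace_pow_sum (N := 2 * m) (by omega) hNn
  rw [hN, h4] at hvar
  rw [hN] at hcov
  rw [hA.integral_normalizedTrace_sub_linearStatistic_sq, variance_const_mul_sub_const_mul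
    (hA.memLp_trace_pow _) hA.memLp_sum_symmEntry, hA.variance_sum_symmEntry]
  set K : ℝ := 2 * m * (n * p : ℝ) ^ (2 * m - 1)
  have hK : 0 < K := by positivity
  have hs0 : 0 < √(p * (1 - p) : ℝ) := Real.sqrt_pos.2 (mul_pos hp (sub_pos.2 hp1))
  have hs : √(p * (1 - p) : ℝ) ^ 2 = p * (1 - p) :=
    Real.sq_sqrt (mul_nonneg hp.le (sub_nonneg.2 hp1.le))
  set s : ℝ := √(p * (1 - p))
  rw [← hs] at hvar hcov ⊢
  set R : ℝ := (4 * m) ^ 6 / (n * p) + n ^ 2 * ((4 * m) ^ 2 / (n * p)) ^ d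
  calc _ ≤ (K * s)⁻¹ ^ 2 * (K ^ 2 * s ^ 2 * (2 + 3 * R)) -
          2 * (K * s)⁻¹ * (2 / (n * s)) * (K * s ^ 2 * (n - (2 * m) ^ 2)) +
          (2 / (n * s)) ^ 2 * (n * (n + 1) / 2 * s ^ 2) := by gcongr
    _ = 3 * R + (16 * m ^ 2 + 2) / n := by
        field_simp
        ring

end IsSymmBernoulliMatrix

end LinearStatistic

section Asymptotics

lemma sq_mul_div_pow_le_inv {x y ε K : ℝ} {d : ℕ} (hx : 1 ≤ x) (hK : 0 ≤ K) (hKx : K ^ 3 ≤ x ^ ε)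
    (hxy : x ^ ε ≤ y) (hd : 9 ≤ 2 * ε * d) : x ^ 2 * (K / y) ^ d ≤ x⁻¹ := by
  have hx0 : 0 < x := one_pos.trans_le hx
  have hpow : 0 < x ^ ε := Real.rpow_pos_of_pos hx0 ε
  have hy : 0 < y := hpow.trans_le hxy
  have hratio : (K / y) ^ 3 ≤ x ^ (-(2 * ε)) :=
    calc (K / y) ^ 3 = K ^ 3 / y ^ 3 := div_pow K y 3
      _ ≤ x ^ ε / (x ^ ε) ^ 3 := by gcongr
      _ = ((x ^ ε) ^ 2)⁻¹ := by field_simp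
      _ = x ^ (-(2 * ε)) := by rw [Real.rpow_neg hx0.le, mul_comm, Real.rpow_mul hx0.le,
          Real.rpow_two]
  have hcube : ((K / y) ^ d) ^ 3 ≤ ((x ^ 3)⁻¹) ^ 3 :=
    calc ((K / y) ^ d) ^ 3 = ((K / y) ^ 3) ^ d := by rw [← pow_mul, ← pow_mul, mul_comm]
      _ ≤ (x ^ (-(2 * ε))) ^ d := by gcongr
      _ = x ^ (-(2 * ε * d)) := by rw [← Real.rpow_mul_natCast hx0.le, neg_mul]
      _ ≤ x ^ (-(9 : ℕ) : ℝ) :=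
        Real.rpow_le_rpow_of_exponent_le hx (neg_le_neg (by exact_mod_cast hd))
      _ = ((x ^ 3)⁻¹) ^ 3 := by rw [Real.rpow_neg hx0.le, Real.rpow_natCast]; ring
  calc x ^ 2 * (K / y) ^ d ≤ x ^ 2 * (x ^ 3)⁻¹ := by
        gcongr
        exact (pow_le_pow_iff_left₀ (by positivity) (by positivity) three_ne_zero).1 hcube
    _ = x⁻¹ := by field_simp

lemma rpow_le_mul_of_rpow_sub_one_le {x y ε : ℝ} (hx : 0 < x) (h : x ^ (ε - 1) ≤ y) :
    x ^ ε ≤ x * y := by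
  rw [Real.rpow_sub_one hx.ne', div_le_iff₀ hx] at h
  rwa [mul_comm]

variable {ε₀ : ℝ} {p : ℕ → unitInterval} {m : ℕ → ℕ} {Ω : ℕ → Type*}
  [∀ n, MeasurableSpace (Ω n)] {P : ∀ n, Measure (Ω n)} [∀ n, IsProbabilityMeasure (P n)]
  {A : ∀ n, Ω n → Matrix (Fin n) (Fin n) ℝ}

theorem tendstoInDistribution_linearStatistic
    (hp : Tendsto (fun n : ℕ ↦ (n : ℝ) ^ 2 * (p n * (1 - p n))) atTop atTop)
    (hA : ∀ n, IsSymmBernoulliMatrix (P n) (p n) (A n)) :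
    TendstoInDistribution (fun n ↦ linearStatistic (p n) (A n)) atTop (id : ℝ → ℝ) P
      (gaussianReal 0 2) := by
  set c : ℕ → ℝ := fun n ↦ 2 / (n * √(p n * (1 - p n)))
  have hc : Tendsto c atTop (𝓝 0) := by
    refine Tendsto.const_div_atTop ((Real.tendsto_sqrt_atTop.comp hp).congr fun n ↦ ?_) 2
    rw [Function.comp_apply, Real.sqrt_mul (sq_nonneg _), Real.sqrt_sq n.cast_nonneg]
  have hc0 n : 0 ≤ c n := by positivity
  have hξ n e : AEMeasurable (symmEntry (A n) e) (P n) :=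
    ((hA n).memLp_symmEntry e).aemeasurable
  have hind n : iIndepFun (fun e ω ↦ c n * (symmEntry (A n) e ω - p n)) (P n) :=
    (hA n).iIndepFun_symmEntry.comp (fun _ x ↦ c n * (x - p n)) fun _ ↦ by fun_prop
  have hmean n e : ∫ ω, c n * (symmEntry (A n) e ω - p n) ∂P n = 0 := by
    rw [integral_const_mul, integral_sub (((hA n).memLp_symmEntry e).integrable one_le_two)
      (integrable_const _), (hA n).integral_symmEntry]
    simp
  have hbound n e : ∀ᵐ ω ∂P n, |c n * (symmEntry (A n) e ω - p n)| ≤ c n := by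
    filter_upwards [(hA n).ae_abs_symmEntry_sub_le_one e] with ω hω
    rw [abs_mul, abs_of_nonneg (hc0 n)]
    exact mul_le_of_le_one_right (hc0 n) hω
  have hvar : Tendsto (fun n ↦ ∑ e, Var[fun ω ↦ c n * (symmEntry (A n) e ω - p n); P n]) atTop
      (𝓝 2) := by
    have hlim : Tendsto (fun n : ℕ ↦ 2 + 2 / (n : ℝ)) atTop (𝓝 2) := by
      simpa using (tendsto_const_div_atTop_nhds_zero_nat (2 : ℝ)).const_add 2
    refine hlim.congr' ?_
    filter_upwards [hp.eventually_gt_atTop 0, eventually_ne_atTop 0] with n hn hn0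
    exact ((hA n).sum_variance_const_mul_symmEntry_sub hn0
      (pos_of_mul_pos_right hn (sq_nonneg _))).symm
  exact tendstoInDistribution_sum_gaussianReal
    (fun n e ↦ ((hξ n e).sub_const _).const_mul _) hind hmean hbound hc hvar

theorem tendsto_integral_normalizedTrace_sub_linearStatistic_sq (hε : 0 < ε₀)
    (hp : ∀ᶠ n : ℕ in atTop, (n : ℝ) ^ (ε₀ - 1) ≤ p n) (hp1 : ∀ᶠ n in atTop, (p n : ℝ) < 1)
    (hm : ∀ᶠ n in atTop, 9 ≤ ε₀ * m n)
    (hm' : (fun n ↦ (m n : ℝ) ^ 6) =o[atTop] fun n ↦ (n : ℝ) ^ ε₀)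
    (hA : ∀ n, IsSymmBernoulliMatrix (P n) (p n) (A n)) :
    Tendsto (fun n ↦ ∫ ω, (normalizedTrace (P n) (p n) (m n) (A n) ω -
      linearStatistic (p n) (A n) ω) ^ 2 ∂(P n)) atTop (𝓝 0) := by
  have hlim : Tendsto (fun n : ℕ ↦ 3 * (4 ^ 6 * ((m n : ℝ) ^ 6 / (n : ℝ) ^ ε₀) + 1 / n) +
      18 * ((m n : ℝ) ^ 6 / (n : ℝ) ^ ε₀)) atTop (𝓝 0) := by
    have h := hm'.tendsto_div_nhds_zero
    simpa using (((h.const_mul (4 ^ 6)).add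
      (tendsto_const_div_atTop_nhds_zero_nat (1 : ℝ))).const_mul 3).add (h.const_mul 18)
  refine squeeze_zero' (Eventually.of_forall fun n ↦ integral_nonneg fun ω ↦ sq_nonneg _) ?_ hlim
  filter_upwards [hp, hp1, hm, hm'.bound (c := (4 ^ 6)⁻¹) (by norm_num), eventually_gt_atTop 1]
    with n hpn hpn1 hmn hmn' hn
  have hn1 : (1 : ℝ) < n := by exact_mod_cast hn
  have hpow : 0 < (n : ℝ) ^ ε₀ := by positivity
  have hnp : (n : ℝ) ^ ε₀ ≤ n * p n := rpow_le_mul_of_rpow_sub_one_le (by positivity) hpn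
  have hp0 : 0 < (p n : ℝ) := (Real.rpow_pos_of_pos (by positivity) _).trans_le hpn
  have hpown : (n : ℝ) ^ ε₀ ≤ n := hnp.trans (mul_le_of_le_one_right (by positivity) hpn1.le)
  have hm9 : (9 : ℝ) ≤ m n := by
    have hε1 : ε₀ ≤ 1 := (Real.rpow_le_rpow_left_iff hn1).1 (by rwa [Real.rpow_one])
    nlinarith
  have hm6 : ((4 * m n : ℝ) ^ 2) ^ 3 ≤ (n : ℝ) ^ ε₀ := by
    rw [Real.norm_of_nonneg (by positivity), Real.norm_of_nonneg hpow.le] at hmn'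
    linarith
  have hd : (m n : ℝ) ≤ 2 * ((2 * m n + 3) / 4 : ℕ) := by exact_mod_cast (by omega)
  have hm2 : (4 * m n : ℝ) ^ 2 ≤ n * p n :=
    ((le_self_pow₀ (by nlinarith) three_ne_zero).trans hm6).trans hnp
  calc _ ≤ _ := (hA n).integral_normalizedTrace_sub_linearStatistic_sq_le
        (by exact_mod_cast (by linarith : (2 : ℝ) ≤ m n)) (d := (2 * m n + 3) / 4) (by omega)
        hp0 hpn1 hm2
    _ ≤ 3 * ((4 * m n : ℝ) ^ 6 / (n : ℝ) ^ ε₀ + (n : ℝ)⁻¹) + 18 * m n ^ 6 / (n : ℝ) ^ ε₀ := by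
        gcongr
        · exact sq_mul_div_pow_le_inv hn1.le (by positivity) hm6 hnp (by nlinarith)
        · nlinarith [pow_le_pow_right₀ (by linarith : (1 : ℝ) ≤ m n) (by norm_num : 2 ≤ 6),
            one_le_pow₀ (by linarith : (1 : ℝ) ≤ m n) (n := 2)]
    _ = _ := by ring

lemma tendsto_sq_mul_mul_one_sub_atTop (hε : 0 < ε₀)
    (hp : ∀ᶠ n : ℕ in atTop, (n : ℝ) ^ (ε₀ - 1) ≤ p n ∧ (p n : ℝ) ≤ 1 / 2) :
    Tendsto (fun n : ℕ ↦ (n : ℝ) ^ 2 * (p n * (1 - p n))) atTop atTop := by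
  refine tendsto_atTop_mono' atTop ?_
    (tendsto_natCast_atTop_atTop.atTop_div_const (two_pos : (0 : ℝ) < 2))
  filter_upwards [hp, eventually_ge_atTop 1] with n ⟨hpn, hpn'⟩ hn
  have hn1 : (1 : ℝ) ≤ n := by exact_mod_cast hn
  have hnp : 1 ≤ n * (p n : ℝ) := (Real.one_le_rpow hn1 hε.le).trans
    (rpow_le_mul_of_rpow_sub_one_le (by positivity) hpn)
  calc (n : ℝ) / 2 = n * (1 * (1 / 2)) := by ring
    _ ≤ n * ((n * p n) * (1 - p n)) := by gcongr; linarith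
    _ = (n : ℝ) ^ 2 * (p n * (1 - p n)) := by ring

lemma isLittleO_pow_six_rpow {c : ℝ} (hc : c ≤ 1) (hε : 0 < ε₀)
    (hm : ∀ᶠ n : ℕ in atTop, (m n : ℝ) ≤ c * Real.log n / Real.log (Real.log n)) :
    (fun n ↦ (m n : ℝ) ^ 6) =o[atTop] fun n ↦ (n : ℝ) ^ ε₀ := by
  have hlog : Tendsto (fun n : ℕ ↦ Real.log n) atTop atTop :=
    Real.tendsto_log_atTop.comp tendsto_natCast_atTop_atTop
  have hbound : (fun n ↦ (m n : ℝ) ^ 6) =O[atTop] fun n : ℕ ↦ Real.log n ^ (6 : ℝ) := by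
    refine Asymptotics.IsBigO.of_bound' ?_
    filter_upwards [hm, hlog.eventually_ge_atTop 0,
      hlog.eventually (Real.tendsto_log_atTop.eventually_ge_atTop 1)] with n hmn hl hll
    have hml : (m n : ℝ) ≤ Real.log n := hmn.trans ((div_le_iff₀ (by linarith)).2 (by nlinarith))
    rw [Real.norm_of_nonneg (by positivity), Real.norm_of_nonneg (by positivity)]
    exact_mod_cast pow_le_pow_left₀ (m n).cast_nonneg hml 6
  exact hbound.trans_isLittleO
    ((isLittleO_log_rpow_rpow_atTop 6 hε).comp_tendsto tendsto_natCast_atTop_atTop)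

end Asymptotics

theorem theorem1_general {ε₀ : ℝ} {p : ℕ → unitInterval} {m : ℕ → ℕ} {Ω : ℕ → Type*}
    [∀ n, MeasurableSpace (Ω n)] {P : ∀ n, Measure (Ω n)} [∀ n, IsProbabilityMeasure (P n)]
    {A : ∀ n, Ω n → Matrix (Fin n) (Fin n) ℝ} (hε : 0 < ε₀)
    (hp : ∀ᶠ n : ℕ in atTop, (n : ℝ) ^ (ε₀ - 1) ≤ p n)
    (hvar : Tendsto (fun n : ℕ ↦ (n : ℝ) ^ 2 * (p n * (1 - p n))) atTop atTop)
    (hm : ∀ᶠ n in atTop, 9 ≤ ε₀ * m n)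
    (hm' : (fun n ↦ (m n : ℝ) ^ 6) =o[atTop] fun n ↦ (n : ℝ) ^ ε₀)
    (hA : ∀ n, IsSymmBernoulliMatrix (P n) (p n) (A n)) :
    TendstoInDistribution (fun n ↦ normalizedTrace (P n) (p n) (m n) (A n)) atTop
      (id : ℝ → ℝ) P (gaussianReal 0 2) := by
  have hp1 : ∀ᶠ n in atTop, (p n : ℝ) < 1 := by
    filter_upwards [hvar.eventually_gt_atTop 0] with n hn
    exact sub_pos.1 (pos_of_mul_pos_right (pos_of_mul_pos_right hn (sq_nonneg _)) (p n).2.1)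
  exact tendstoInDistribution_of_tendsto_integral_sub_sq
    (fun n ↦ (hA n).memLp_normalizedTrace _ _) (fun n ↦ (hA n).memLp_linearStatistic _)
    (tendstoInDistribution_linearStatistic hvar hA)
    (tendsto_integral_normalizedTrace_sub_linearStatistic_sq hε hp hp1 hm hm' hA)

theorem theorem1 :
    ∃ c₀ : ℝ, 0 < c₀ ∧
      ∀ ε₀ : ℝ, 0 < ε₀ → ε₀ < 1 →
      ∀ p : ℕ → unitInterval,
      (∀ᶠ n : ℕ in atTop, (n : ℝ) ^ (ε₀ - 1) ≤ (p n : ℝ) ∧ (p n : ℝ) ≤ 1 / 2) →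
      ∀ m : ℕ → ℕ,
      (∀ᶠ n : ℕ in atTop, 1 / (c₀ * ε₀) ≤ (m n : ℝ) ∧
        (m n : ℝ) ≤ c₀ * ε₀ * Real.log n / Real.log (Real.log n)) →
      ∀ (Ω : ℕ → Type*) [∀ n, MeasurableSpace (Ω n)] (P : ∀ n, Measure (Ω n))
        [∀ n, IsProbabilityMeasure (P n)] (A : ∀ n, Ω n → Matrix (Fin n) (Fin n) ℝ),
      (∀ n, IsSymmBernoulliMatrix (P n) (p n) (A n)) →
      TendstoInDistribution (fun n ↦ normalizedTrace (P n) (p n : ℝ) (m n) (A n)) atTop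
        (id : ℝ → ℝ) P (gaussianReal 0 2) := by
  -- If `m ^ 6 = o(n ^ ε₀)`, the error `n ^ 2 * ((4 * m) ^ 2 / n ^ ε₀) ^ (m / 2)` from pairs of
  -- walks with at least `m / 2` coincidences is at most `1 / n` as soon as `9 ≤ ε₀ * m`.
  refine ⟨1 / 9, by norm_num, fun ε₀ hε hε1 p hp m hm Ω _ P _ A hA ↦ ?_⟩
  exact theorem1_general hε (hp.mono fun n hn ↦ hn.1) (tendsto_sq_mul_mul_one_sub_atTop hε hp)
    (hm.mono fun n hn ↦ by linarith [(div_le_iff₀ (by positivity)).1 hn.1])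
    (isLittleO_pow_six_rpow (by linarith) hε (hm.mono fun n hn ↦ hn.2)) hA
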